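/- Let $1/2<H<1$, let $c,k,\sigma\in\mathbb R$, $\sigma_0>0$ and $\mu_0\in\mathbb R^2$. Let $B^H=(B^H(t))_{t\ge 0}$ be a fractional Brownian motion with Hurst index $H$ (a centred Gaussian process with almost surely continuous paths and covariance $\tfrac12\big(s^{2H}+t^{2H}-|t-s|^{2H}\big)$), and let the fractional Gaussian noise $\xi^H$ be its formal derivative. Let $(X,V)$, $V=\dot X$, be a solution with continuous paths of the linear oscillator $$\ddot X+c\dot X+kX=\sigma\,\xi^H,$$ that is, almost surely, for all $t\ge0$, $$X(t)=X(0)+\int_0^tV(s)\,ds,\qquad V(t)=V(0)-\int_0^t\big(kX(s)+cV(s)\big)\,ds+\sigma B^H(t),$$ where $(X(0),V(0))$ is independent of $B^H$ and has the Gaussian density of $N(\mu_0,\Sigma_0)$ with $\Sigma_0=\sigma_0^2I$. Put $$A=\begin{pmatrix}0&1\\-k&-c\end{pmatrix},\qquad \Sigma=\begin{pmatrix}0&0\\0&\sigma\end{pmatrix}.$$ Then: 1. The response $(X(t),V(t))_{t\ge0}$ is a Gaussian process. For every $t\ge 0$ its mean vector and covariance matrix are $$\mu(t)=e^{At}\mu_0,\qquad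 \Sigma(t)=e^{At}\Sigma_0e^{A^Tt}+H(2H-1)\int_0^t\!\!\int_0^te^{A(t-u)}\Sigma\Sigma^Te^{A^T(t-v)}|u-v|^{2H-2}\,du\,dv,$$ and $\Sigma(t)$ is positive definite. 2. For every $t\ge0$ the pair $(X(t),V(t))$ has a smooth joint density $p(\cdot,\cdot,t)$, and with $\boldsymbol x=(x,v)^T$ $$p(x,v,t)=\frac{1}{2\pi|\Sigma(t)|^{1/2}}\exp\Big\{-\tfrac12(\boldsymbol x-\mu(t))^T\Sigma(t)^{-1}(\boldsymbol x-\mu(t))\Big\}.$$ 3. For all $x,v\in\mathbb R$ and $t\ge0$ (with the right derivative in time at $t=0$), $p$ satisfies the memFPK equation $$\frac{\partial p}{\partial t}=-\frac{\partial}{\partial x}\{v\,p\}+\frac{\partial}{\partial v}\{(kx+cv)\,p\}+b_{21}(t)\frac{\partial^2p}{\partial v\,\partial x}+b_{22}(t)\frac{\partial^2p}{\partial v^2},$$ with the time-dependent diffusion coefficients $$b_{21}(t)=H(2H-1)\sigma^2\int_0^t\big[e^{A(t-s)}\big]_{12}|t-s|^{2H-2}\,ds,\qquad b_{22}(t)=H(2H-1)\sigma^2\int_0^t\big[e^{A(t-s)}\big]_{22}|t-s|^{2H-2}\,ds.$$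 -/

import Mathlib

open MeasureTheory ProbabilityTheory Matrix Set
open scoped NNReal ENNReal

noncomputable section

namespace FGNOscillator

/-- Fractional Brownian motion with Hurst index `H` on the time axis `[0, ∞)`: a centred Gaussian
process with covariance `(s ^ (2H) + t ^ (2H) - |t - s| ^ (2H)) / 2` and almost surely continuous
paths. The unit fractional Gaussian noise is its formal time derivative. -/
structure IsFractionalBrownianMotion {Ω : Type*} [MeasurableSpace Ω] (H : ℝ)
    (B : ℝ≥0 → Ω → ℝ) (P : Measure Ω) : Prop where
  gaussian : IsGaussianProcess B P
  mean_zero : ∀ t, ∫ ω, B t ω ∂P = 0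
  covariance : ∀ s t : ℝ≥0,
    cov[B s, B t; P] =
      ((s : ℝ) ^ (2 * H) + (t : ℝ) ^ (2 * H) - |(t : ℝ) - (s : ℝ)| ^ (2 * H)) / 2
  continuous_paths : ∀ᵐ ω ∂P, Continuous fun t => B t ω

/-- `(X, V)` solves `X'' + c X' + k X = σ ξ`, where `V = X'` and `ξ = dB/dt`, that is
`dX = V dt`, `dV = -(k X + c V) dt + σ dB`, in integrated form along almost every path.
(The noise is additive with a constant coefficient, so `∫₀ᵗ σ dB = σ (B t - B 0)` for every notion
of stochastic integral.) -/
def IsOscillatorSolution {Ω : Type*} [MeasurableSpace Ω] (c k σ : ℝ)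
    (B X V : ℝ≥0 → Ω → ℝ) (P : Measure Ω) : Prop :=
  ∀ᵐ ω ∂P,
    Continuous (fun t => X t ω) ∧ Continuous (fun t => V t ω) ∧
    ∀ t : ℝ≥0,
      X t ω = X 0 ω + ∫ s in (0 : ℝ)..t, V s.toNNReal ω ∧
      V t ω = V 0 ω - (∫ s in (0 : ℝ)..t, (k * X s.toNNReal ω + c * V s.toNNReal ω))
        + σ * (B t ω - B 0 ω)

/-- The matrix `A` of the first-order system. -/
def driftMatrix (c k : ℝ) : Matrix (Fin 2) (Fin 2) ℝ := !![0, 1; -k, -c]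

/-- The noise intensity matrix `Σ`. -/
def noiseMatrix (σ : ℝ) : Matrix (Fin 2) (Fin 2) ℝ := !![0, 0; 0, σ]

/-- The matrix exponential `e^{A t}`. -/
def flow (c k t : ℝ) : Matrix (Fin 2) (Fin 2) ℝ := NormedSpace.exp (t • driftMatrix c k)

/-- The mean vector `e^{A t} μ₀`. -/
def responseMean (c k : ℝ) (μ₀ : Fin 2 → ℝ) (t : ℝ) : Fin 2 → ℝ := flow c k t *ᵥ μ₀

/-- The covariance matrix `e^{A t} Σ₀ e^{Aᵀ t}
+ H (2H - 1) ∫₀ᵗ ∫₀ᵗ e^{A (t - u)} Σ Σᵀ e^{Aᵀ (t - v)} |u - v| ^ (2H - 2) du dv`,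
with entrywise integrals. -/
def responseCov (H c k σ : ℝ) (S₀ : Matrix (Fin 2) (Fin 2) ℝ) (t : ℝ) :
    Matrix (Fin 2) (Fin 2) ℝ :=
  flow c k t * S₀ * NormedSpace.exp (t • (driftMatrix c k)ᵀ) +
    Matrix.of fun i j =>
      H * (2 * H - 1) * ∫ v in (0 : ℝ)..t, ∫ u in (0 : ℝ)..t,
        (flow c k (t - u) * (noiseMatrix σ * (noiseMatrix σ)ᵀ) *
          NormedSpace.exp ((t - v) • (driftMatrix c k)ᵀ)) i j * |u - v| ^ (2 * H - 2)

/-- The diffusion coefficient `H (2H - 1) σ² ∫₀ᵗ [e^{A (t - s)}]_{i j} |t - s| ^ (2H - 2) ds`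
(indices start from `0`). -/
def memDiffusion (H c k σ : ℝ) (i j : Fin 2) (t : ℝ) : ℝ :=
  H * (2 * H - 1) * σ ^ 2 * ∫ s in (0 : ℝ)..t, flow c k (t - s) i j * |t - s| ^ (2 * H - 2)

/-- The bivariate Gaussian density with mean `m` and covariance `S` (positive definite). -/
def gaussianDensity (m : Fin 2 → ℝ) (S : Matrix (Fin 2) (Fin 2) ℝ) (x : Fin 2 → ℝ) : ℝ :=
  1 / (2 * Real.pi * Real.sqrt S.det) * Real.exp (-(1 / 2) * ((x - m) ⬝ᵥ (S⁻¹ *ᵥ (x - m))))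

/-- `f` is a joint probability density of the pair `(X, V)` of real random variables. -/
def IsJointPDF {Ω : Type*} [MeasurableSpace Ω] (X V : Ω → ℝ) (P : Measure Ω)
    (f : ℝ → ℝ → ℝ) : Prop :=
  AEMeasurable X P ∧ AEMeasurable V P ∧ (∀ x v, 0 ≤ f x v) ∧
    P.map (fun ω => (X ω, V ω)) =
      (volume : Measure (ℝ × ℝ)).withDensity fun z => ENNReal.ofReal (f z.1 z.2)

/-- The right-hand side of the memory-dependent Fokker-Planck-Kolmogorov equation
`∂p/∂t = -∂/∂x {v p} + ∂/∂v {(k x + c v) p} + b₂₁ ∂²p/∂v∂x + b₂₂ ∂²p/∂v²`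
for a function `q` of the state `(x, v)`, with coefficients `b₂₁`, `b₂₂` that do not depend on
the state. -/
def memFPKOperator (c k b₂₁ b₂₂ : ℝ) (q : ℝ → ℝ → ℝ) (x v : ℝ) : ℝ :=
  -deriv (fun x' => v * q x' v) x
    + deriv (fun v' => (k * x + c * v') * q x v') v
    + b₂₁ * deriv (fun v' => deriv (fun x' => q x' v') x) v
    + b₂₂ * deriv (fun v' => deriv (fun v'' => q x v'') v') v

end FGNOscillator

end

/-! The noise is additive, so the equation is solved path by path. The function V - σB is C¹, and
variation of constants writes the state as e^{At}(X(0), V(0)) plus σ times B(t)e₂ + ∫₀ᵗ φ'(t-s)B(s)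
ds, where φ is the second column of the flow (`oscillator_variation_of_constants`). No stochastic
integral has to be constructed.

The time integral is an almost sure limit of Riemann sums, and almost sure limits of centred
Gaussian variables are centred Gaussian with convergent variances (`hasGaussianLaw_of_tendsto`).
Hence the centred state lives in a linear space of centred Gaussian variables, which gives the
Gaussian process and lets covariances pass through the integrals. They come out as integrals of the
covariance R of B against φ'. Since ∂ᵤ∂ᵥR = H(2H-1)|u-v|^{2H-2}, integrating by parts in each
variable produces the Riesz energy in Σ(t) (`integral_integral_riesz_eq_noiseCov`). So the second
summand of Σ(t) is a genuine covariance, hence positive semidefinite, while the first is positive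
definite because the flow is invertible. A nondegenerate Gaussian pair has the explicit density.

For the memFPK equation it suffices that μ' = Aμ and Σ' = AΣ + ΣAᵀ + b e₂ᵀ + e₂ bᵀ with b = (b₂₁,
b₂₂); differentiating the explicit density then gives the equation (`hasDerivWithinAt_bivariate`).
The delicate point is differentiating a double integral with a singular kernel. Splitting it along
the diagonal and pulling it back by the flow gives e^{At}(∫₀ᵗ m(s) ds)e^{Aᵀt} with m continuous
(`rieszEnergy_eq`), to which the product rule applies. -/

namespace FGNOscillator

/-! ### The matrix flow and its entrywise derivatives. -/

section Flow

open scoped Matrix.Norms.Operator in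
theorem hasDerivAt_flow_matrix (c k t : ℝ) :
    HasDerivAt (flow c k) (flow c k t * driftMatrix c k) t :=
  hasDerivAt_exp_smul_const (driftMatrix c k) t

theorem flow_mul_drift_comm (c k t : ℝ) :
    flow c k t * driftMatrix c k = driftMatrix c k * flow c k t :=
  (((Commute.refl (driftMatrix c k)).smul_right t).exp_right).eq.symm

open scoped Matrix.Norms.Operator in
theorem hasDerivAt_flow (c k t : ℝ) (i j : Fin 2) :
    HasDerivAt (fun s => flow c k s i j) ((flow c k t * driftMatrix c k) i j) t := by
  have h := hasDerivAt_flow_matrix c k t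
  exact hasDerivAt_pi.1 (hasDerivAt_pi.1 h i) j

theorem hasDerivAt_flow' (c k t : ℝ) (i j : Fin 2) :
    HasDerivAt (fun s => flow c k s i j) ((driftMatrix c k * flow c k t) i j) t := by
  rw [← flow_mul_drift_comm]; exact hasDerivAt_flow c k t i j

theorem continuous_flow (c k : ℝ) (i j : Fin 2) : Continuous fun s => flow c k s i j :=
  continuous_iff_continuousAt.2 fun t => (hasDerivAt_flow c k t i j).continuousAt

theorem flow_zero (c k : ℝ) : flow c k 0 = 1 := by
  simp [flow]

theorem flow_add (c k s t : ℝ) : flow c k (s + t) = flow c k s * flow c k t := by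
  unfold flow
  rw [add_smul, Matrix.exp_add_of_commute]
  exact ((Commute.refl (driftMatrix c k)).smul_right t).smul_left s

theorem flow_mul_flow_neg (c k t : ℝ) : flow c k t * flow c k (-t) = 1 := by
  rw [← flow_add, add_neg_cancel, flow_zero]

theorem exp_smul_drift_transpose (c k t : ℝ) :
    NormedSpace.exp (t • (driftMatrix c k)ᵀ) = (flow c k t)ᵀ := by
  rw [flow, ← Matrix.exp_transpose, transpose_smul]

/-- The derivative of the second column of the flow. -/
noncomputable def flowDeriv (c k : ℝ) (i : Fin 2) (t : ℝ) : ℝ := flow c k t i 0 - c * flow c k t i 1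

theorem hasDerivAt_flow_one (c k t : ℝ) (i : Fin 2) :
    HasDerivAt (fun s => flow c k s i 1) (flowDeriv c k i t) t := by
  convert! hasDerivAt_flow c k t i 1 using 1
  simp [driftMatrix, flowDeriv, Matrix.mul_apply, Fin.sum_univ_two]
  ring

theorem hasDerivAt_flow_zero (c k t : ℝ) (i : Fin 2) :
    HasDerivAt (fun s => flow c k s i 0) (-k * flow c k t i 1) t := by
  convert! hasDerivAt_flow c k t i 0 using 1
  simp [driftMatrix, Matrix.mul_apply, Fin.sum_univ_two]
  ring

theorem continuous_flowDeriv (c k : ℝ) (i : Fin 2) : Continuous (flowDeriv c k i) :=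
  (continuous_flow c k i 0).sub (continuous_const.mul (continuous_flow c k i 1))

end Flow

/-! ### Integrability of the singular kernel and splitting along the diagonal. -/

section Kernel

theorem intervalIntegrable_abs_sub_rpow {γ : ℝ} (hγ : -1 < γ) (s a b : ℝ) :
    IntervalIntegrable (fun v => |s - v| ^ γ) volume a b := by
  have h : ∀ x y : ℝ, IntervalIntegrable (fun v : ℝ => |v| ^ γ) volume x y := by
    have h0 : ∀ y : ℝ, IntervalIntegrable (fun v : ℝ => |v| ^ γ) volume 0 y := by
      have hpos : ∀ y : ℝ, 0 ≤ y → IntervalIntegrable (fun v : ℝ => |v| ^ γ) volume 0 y := by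
        intro y hy
        refine (intervalIntegral.intervalIntegrable_rpow' (a := 0) (b := y) hγ).congr ?_
        intro v hv
        rw [uIoc_of_le hy] at hv
        simp [abs_of_pos hv.1]
      intro y
      rcases le_total 0 y with hy | hy
      · exact hpos y hy
      · have := IntervalIntegrable.comp_sub_left (hpos (-y) (by linarith)) 0
        simpa using this
    exact fun x y => (h0 x).symm.trans (h0 y)
  have := (h (s - a) (s - b)).comp_sub_left s
  simpa using this

/-- On the square (0, t]² only differences in (-t, t] occur, so the kernel may be truncated to an
integrable function on the line. The product with `a` is then a convolution integrand, and `b` is a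
bounded factor. -/
theorem integrable_mul_abs_sub_rpow {γ : ℝ} (hγ : -1 < γ) {a b : ℝ → ℝ} (ha : Continuous a)
    (hb : Continuous b) {t : ℝ} (ht : 0 ≤ t) :
    Integrable (Function.uncurry fun v u : ℝ => a u * b v * |u - v| ^ γ)
      ((volume.restrict (Ioc 0 t)).prod (volume.restrict (Ioc 0 t))) := by
  have hk : Integrable ((Ioc (-t) t).indicator fun x : ℝ => |x| ^ γ) volume := by
    rw [integrable_indicator_iff measurableSet_Ioc,
      ← intervalIntegrable_iff_integrableOn_Ioc_of_le (by linarith)]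
    simpa using intervalIntegrable_abs_sub_rpow hγ 0 (-t) t
  have ha' : Integrable a (volume.restrict (Ioc 0 t)) :=
    (ha.integrableOn_Icc (μ := volume)).mono_set Ioc_subset_Icc_self
  have h1 : Integrable (fun p : ℝ × ℝ => a p.2 * (Ioc (-t) t).indicator (fun x : ℝ => |x| ^ γ)
      (p.1 - p.2)) (volume.prod (volume.restrict (Ioc 0 t))) := by
    simpa using Integrable.convolution_integrand (ContinuousLinearMap.mul ℝ ℝ)
      (μ := volume) ha' hk
  have h2 : Integrable (fun p : ℝ × ℝ => a p.2 * (Ioc (-t) t).indicator (fun x : ℝ => |x| ^ γ)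
      (p.1 - p.2)) ((volume.restrict (Ioc 0 t)).prod (volume.restrict (Ioc 0 t))) :=
    h1.mono_measure (Measure.prod_mono Measure.restrict_le_self le_rfl)
  obtain ⟨C, hC⟩ := isCompact_Icc.exists_bound_of_continuousOn (s := Icc 0 t) hb.continuousOn
  have hmem : ∀ᵐ p ∂((volume.restrict (Ioc 0 t)).prod (volume.restrict (Ioc 0 t))),
      p ∈ Ioc (0 : ℝ) t ×ˢ Ioc (0 : ℝ) t := by
    rw [Measure.prod_restrict]
    exact ae_restrict_mem (measurableSet_Ioc.prod measurableSet_Ioc)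
  have h3 := h2.bdd_mul (f := fun p : ℝ × ℝ => b p.1) (c := C)
    (hb.comp continuous_fst).aestronglyMeasurable
    (by filter_upwards [hmem] with p hp using hC p.1 (Ioc_subset_Icc_self hp.1))
  refine h3.congr ?_
  filter_upwards [hmem] with p hp
  have : p.1 - p.2 ∈ Ioc (-t) t := by
    obtain ⟨⟨h1, h2⟩, h3, h4⟩ := hp
    constructor <;> linarith
  simp only [Function.uncurry, indicator_of_mem this, abs_sub_comm p.1 p.2]
  ring

/-- Splitting of the energy integral with a Riesz kernel along the diagonal of the square. -/
theorem integral_integral_riesz_eq_triangle {γ : ℝ} (hγ : -1 < γ) {a b : ℝ → ℝ}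
    (ha : Continuous a) (hb : Continuous b) {t : ℝ} (ht : 0 ≤ t) :
    ∫ v in (0 : ℝ)..t, ∫ u in (0 : ℝ)..t, a u * b v * |u - v| ^ γ =
      ∫ s in (0 : ℝ)..t, (b s * (∫ u in (0 : ℝ)..s, a u * |s - u| ^ γ) +
        a s * ∫ v in (0 : ℝ)..s, b v * |s - v| ^ γ) := by
  set μ := (volume : Measure ℝ).restrict (Ioc 0 t) with hμ
  have hK := integrable_mul_abs_sub_rpow hγ ha hb ht
  set K : ℝ → ℝ → ℝ := fun v u => a u * b v * |u - v| ^ γ with hKdef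
  let D : Set (ℝ × ℝ) := {p | p.2 ≤ p.1}
  have hD : MeasurableSet D := measurableSet_le measurable_snd measurable_fst
  have hK1 : Integrable (D.indicator (Function.uncurry K)) (μ.prod μ) := hK.indicator hD
  have hK2 : Integrable (Dᶜ.indicator (Function.uncurry K)) (μ.prod μ) := hK.indicator hD.compl
  have hs : ∫ v, ∫ u, K v u ∂μ ∂μ = (∫ v, ∫ u, D.indicator (Function.uncurry K) (v, u) ∂μ ∂μ) +
      ∫ u, ∫ v, Dᶜ.indicator (Function.uncurry K) (v, u) ∂μ ∂μ := by
    rw [← integral_prod_symm _ hK2, ← integral_prod _ hK1, ← integral_add hK1 hK2,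
      show ∫ v, ∫ u, K v u ∂μ ∂μ = _ from (integral_prod (Function.uncurry K) hK).symm]
    congr 1
    ext p
    exact (Set.indicator_self_add_compl_apply D (Function.uncurry K) p).symm
  have e1 : ∀ v ∈ Ioc (0 : ℝ) t, ∫ u, D.indicator (Function.uncurry K) (v, u) ∂μ =
      b v * ∫ u in (0 : ℝ)..v, a u * |v - u| ^ γ := by
    intro v hv
    have : (fun u => D.indicator (Function.uncurry K) (v, u)) =
        (Iic v).indicator fun u => K v u := by
      ext u
      by_cases h : u ≤ v <;> simp [D, indicator, h]
    rw [this, integral_indicator measurableSet_Iic, hμ, Measure.restrict_restrict measurableSet_Iic,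
      inter_comm, Ioc_inter_Iic, min_eq_right hv.2, ← intervalIntegral.integral_of_le hv.1.le,
      ← intervalIntegral.integral_const_mul]
    congr 1
    ext u
    simp only [hKdef, abs_sub_comm v u]
    ring
  have e2 : ∀ u ∈ Ioc (0 : ℝ) t, ∫ v, Dᶜ.indicator (Function.uncurry K) (v, u) ∂μ =
      a u * ∫ v in (0 : ℝ)..u, b v * |u - v| ^ γ := by
    intro u hu
    have : (fun v => Dᶜ.indicator (Function.uncurry K) (v, u)) =
        (Iio u).indicator fun v => K v u := by
      ext v
      by_cases h : v < u
      · simp [D, indicator, h]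
      · simp [D, indicator, not_lt.1 h]
    -- The diagonal was assigned to the other triangle; it costs only a null set on each slice.
    have hio : Iio u =ᵐ[μ] Iic u := ae_mono (Measure.restrict_le_self) Iio_ae_eq_Iic
    rw [this, integral_indicator measurableSet_Iio, setIntegral_congr_set hio, hμ, Measure.restrict_restrict measurableSet_Iic,
      inter_comm, Ioc_inter_Iic, min_eq_right hu.2, ← intervalIntegral.integral_of_le hu.1.le,
      ← intervalIntegral.integral_const_mul]
    congr 1
    ext v
    simp only [hKdef]
    ring
  have i1 : Integrable (fun v => ∫ u, D.indicator (Function.uncurry K) (v, u) ∂μ) μ :=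
    hK1.integral_prod_left
  have i2 : Integrable (fun u => ∫ v, Dᶜ.indicator (Function.uncurry K) (v, u) ∂μ) μ :=
    hK2.integral_prod_right
  simp only [intervalIntegral.integral_of_le ht]
  rw [← hμ, hs, ← integral_add i1 i2]
  refine integral_congr_ae ?_
  filter_upwards [ae_restrict_mem measurableSet_Ioc] with s hs
  rw [e1 s hs, e2 s hs]

end Kernel

/-! ### The moment equation for the covariance matrix. -/

section CovarianceDerivative

theorem flow_add_one (c k s t : ℝ) (i : Fin 2) :
    flow c k (s + t) i 1 = ∑ a, flow c k s i a * flow c k t a 1 := by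
  rw [flow_add, Matrix.mul_apply]

/-- The response of the oscillator to a Riesz kernel up to time `t`. -/
noncomputable def rieszResponse (γ c k : ℝ) (i : Fin 2) (t : ℝ) : ℝ :=
  ∫ s in (0 : ℝ)..t, flow c k (t - s) i 1 * |t - s| ^ γ

/-- The energy of the second column of the flow with respect to a Riesz kernel. -/
noncomputable def rieszEnergy (γ c k : ℝ) (i j : Fin 2) (t : ℝ) : ℝ :=
  ∫ v in (0 : ℝ)..t, ∫ u in (0 : ℝ)..t,
    flow c k (t - u) i 1 * flow c k (t - v) j 1 * |u - v| ^ γ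

theorem responseCov_apply (H c k σ : ℝ) (S₀ : Matrix (Fin 2) (Fin 2) ℝ) (t : ℝ) (i j : Fin 2) :
    responseCov H c k σ S₀ t i j = (flow c k t * S₀ * (flow c k t)ᵀ) i j +
      H * (2 * H - 1) * σ ^ 2 * rieszEnergy (2 * H - 2) c k i j t := by
  have hN : noiseMatrix σ * (noiseMatrix σ)ᵀ = !![0, 0; 0, σ ^ 2] := by
    ext i j
    fin_cases i <;> fin_cases j <;> simp [noiseMatrix, Matrix.mul_apply, Fin.sum_univ_two, sq]
  have h : ∀ u v : ℝ, (flow c k (t - u) * (noiseMatrix σ * (noiseMatrix σ)ᵀ) *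
      NormedSpace.exp ((t - v) • (driftMatrix c k)ᵀ)) i j * |u - v| ^ (2 * H - 2) =
      σ ^ 2 * (flow c k (t - u) i 1 * flow c k (t - v) j 1 * |u - v| ^ (2 * H - 2)) := by
    intro u v
    rw [exp_smul_drift_transpose, hN]
    simp only [Matrix.mul_apply, Fin.sum_univ_two, transpose_apply]
    simp
    ring
  unfold responseCov rieszEnergy
  rw [exp_smul_drift_transpose, Matrix.add_apply, Matrix.of_apply]
  simp only [h, intervalIntegral.integral_const_mul]
  ring

theorem memDiffusion_eq (H c k σ : ℝ) (i : Fin 2) (t : ℝ) :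
    memDiffusion H c k σ i 1 t = H * (2 * H - 1) * σ ^ 2 * rieszResponse (2 * H - 2) c k i t := rfl

/-- The response, transported back to time `0` by the flow. -/
noncomputable def rieszPullback (γ c k : ℝ) (a : Fin 2) (s : ℝ) : ℝ :=
  ∫ u in (0 : ℝ)..s, flow c k (-u) a 1 * |s - u| ^ γ

variable {γ : ℝ}

theorem intervalIntegrable_flow_mul_riesz (hγ : -1 < γ) {f : ℝ → ℝ} (hf : Continuous f)
    (s a b : ℝ) : IntervalIntegrable (fun u => f u * |s - u| ^ γ) volume a b :=
  (intervalIntegrable_abs_sub_rpow hγ s a b).continuousOn_mul hf.continuousOn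

/-- The group law e^{A(t-u)} = e^{At}e^{-Au} takes `t` out of the singular integral, so that it
survives only in a smooth factor. -/
theorem integral_flow_sub_mul_riesz (hγ : -1 < γ) (c k t s : ℝ) (i : Fin 2) :
    ∫ u in (0 : ℝ)..s, flow c k (t - u) i 1 * |s - u| ^ γ =
      ∑ a, flow c k t i a * rieszPullback γ c k a s := by
  have : ∀ u, flow c k (t - u) i 1 * |s - u| ^ γ =
      flow c k t i 0 * (flow c k (-u) 0 1 * |s - u| ^ γ) +
      flow c k t i 1 * (flow c k (-u) 1 1 * |s - u| ^ γ) := by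
    intro u
    rw [sub_eq_add_neg t, flow_add_one, Fin.sum_univ_two]
    ring
  have hi : ∀ a : Fin 2, IntervalIntegrable
      (fun u => flow c k t i a * (flow c k (-u) a 1 * |s - u| ^ γ)) volume 0 s := fun a =>
    (intervalIntegrable_flow_mul_riesz hγ ((continuous_flow c k a 1).comp continuous_neg)
      s 0 s).const_mul _
  simp only [this]
  rw [intervalIntegral.integral_add (hi 0) (hi 1)]
  simp [Fin.sum_univ_two, rieszPullback]

theorem rieszResponse_eq (hγ : -1 < γ) (c k t : ℝ) (i : Fin 2) :
    rieszResponse γ c k i t = ∑ a, flow c k t i a * rieszPullback γ c k a t :=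
  integral_flow_sub_mul_riesz hγ c k t t i

/-- The substitution w = s - u moves the singularity from the variable point `s` to the fixed point
0. By the group law, `s` then enters only through a smooth factor and as the endpoint of a
primitive. -/
theorem continuous_rieszPullback (hγ : -1 < γ) (c k : ℝ) (a : Fin 2) :
    Continuous (rieszPullback γ c k a) := by
  have hint : ∀ b : Fin 2, ∀ x y : ℝ,
      IntervalIntegrable (fun w => flow c k w b 1 * |0 - w| ^ γ) volume x y := fun b x y =>
    intervalIntegrable_flow_mul_riesz hγ (continuous_flow c k b 1) 0 x y
  have h : ∀ s, rieszPullback γ c k a s =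
      ∑ b, flow c k (-s) a b * ∫ w in (0 : ℝ)..s, flow c k w b 1 * |0 - w| ^ γ := by
    intro s
    have h1 := intervalIntegral.integral_comp_sub_left (a := 0) (b := s)
      (fun w => flow c k (-s + w) a 1 * |0 - w| ^ γ) s
    simp only [sub_self, sub_zero] at h1
    have h2 : rieszPullback γ c k a s =
        ∫ w in (0 : ℝ)..s, flow c k (-s + w) a 1 * |0 - w| ^ γ := by
      rw [← h1, rieszPullback]
      congr 1
      ext u
      rw [show -s + (s - u) = -u by ring, show 0 - (s - u) = -(s - u) by ring, abs_neg]
    have h3 : ∀ w, flow c k (-s + w) a 1 * |0 - w| ^ γ =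
      flow c k (-s) a 0 * (flow c k w 0 1 * |0 - w| ^ γ) +
      flow c k (-s) a 1 * (flow c k w 1 1 * |0 - w| ^ γ) := by
      intro w
      rw [flow_add_one, Fin.sum_univ_two]
      ring
    rw [h2]
    simp only [h3]
    rw [intervalIntegral.integral_add ((hint 0 0 s).const_mul _) ((hint 1 0 s).const_mul _)]
    simp [Fin.sum_univ_two]
  rw [show rieszPullback γ c k a = _ from funext h]
  exact continuous_finsetSum _ fun b _ => ((continuous_flow c k a b).comp continuous_neg).mul
    (intervalIntegral.continuous_primitive (hint b) 0)

/-- The density of the energy, transported back to time `0` by the flow. -/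
noncomputable def energyDensity (γ c k : ℝ) (a b : Fin 2) (s : ℝ) : ℝ :=
  flow c k (-s) b 1 * rieszPullback γ c k a s + flow c k (-s) a 1 * rieszPullback γ c k b s

theorem continuous_energyDensity (hγ : -1 < γ) (c k : ℝ) (a b : Fin 2) :
    Continuous (energyDensity γ c k a b) :=
  (((continuous_flow c k b 1).comp continuous_neg).mul (continuous_rieszPullback hγ c k a)).add
    (((continuous_flow c k a 1).comp continuous_neg).mul (continuous_rieszPullback hγ c k b))

/-- After the diagonal splitting, the group law removes `t` from the integrand: the energy is a
conjugate by the flow of a primitive of a continuous function, hence differentiable. -/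
theorem rieszEnergy_eq (hγ : -1 < γ) (c k : ℝ) {t : ℝ} (ht : 0 ≤ t) (i j : Fin 2) :
    rieszEnergy γ c k i j t = ∑ a, ∑ b, flow c k t i a * flow c k t j b *
      ∫ s in (0 : ℝ)..t, energyDensity γ c k a b s := by
  have hc : ∀ i : Fin 2, Continuous fun u => flow c k (t - u) i 1 := fun i =>
    (continuous_flow c k i 1).comp (continuous_const.sub continuous_id)
  have hE : ∀ a b : Fin 2, IntervalIntegrable
      (fun s => flow c k t i a * flow c k t j b * energyDensity γ c k a b s) volume 0 t :=
    fun a b => ((continuous_energyDensity hγ c k a b).const_mul _).intervalIntegrable _ _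
  rw [rieszEnergy, integral_integral_riesz_eq_triangle hγ (hc i) (hc j) ht]
  simp only [integral_flow_sub_mul_riesz hγ, ← intervalIntegral.integral_const_mul]
  simp only [Fin.sum_univ_two]
  rw [← intervalIntegral.integral_add (hE 0 0) (hE 0 1),
    ← intervalIntegral.integral_add (hE 1 0) (hE 1 1),
    ← intervalIntegral.integral_add ((hE 0 0).add (hE 0 1)) ((hE 1 0).add (hE 1 1))]
  congr 1
  ext s
  simp only [energyDensity, sub_eq_add_neg t, flow_add_one, Fin.sum_univ_two]
  ring

theorem hasDerivWithinAt_rieszEnergy (hγ : -1 < γ) (c k : ℝ) {t : ℝ} (ht : 0 ≤ t) (i j : Fin 2) :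
    HasDerivWithinAt (rieszEnergy γ c k i j)
      ((∑ a, driftMatrix c k i a * rieszEnergy γ c k a j t) +
        (∑ a, driftMatrix c k j a * rieszEnergy γ c k i a t) +
        (rieszResponse γ c k i t * (1 : Matrix (Fin 2) (Fin 2) ℝ) j 1 +
          (1 : Matrix (Fin 2) (Fin 2) ℝ) i 1 * rieszResponse γ c k j t)) (Ici 0) t := by
  have h1 : HasDerivAt (fun t => ∑ a, ∑ b, flow c k t i a * flow c k t j b *
      ∫ s in (0 : ℝ)..t, energyDensity γ c k a b s)
      (∑ a, ∑ b, (((driftMatrix c k * flow c k t) i a * flow c k t j b +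
        flow c k t i a * (driftMatrix c k * flow c k t) j b) *
        (∫ s in (0 : ℝ)..t, energyDensity γ c k a b s) +
        flow c k t i a * flow c k t j b * energyDensity γ c k a b t)) t := by
    refine HasDerivAt.fun_sum fun a _ => HasDerivAt.fun_sum fun b _ => ?_
    exact ((hasDerivAt_flow' c k t i a).mul (hasDerivAt_flow' c k t j b)).mul
      ((continuous_energyDensity hγ c k a b).integral_hasStrictDerivAt 0 t).hasDerivAt
  refine (h1.hasDerivWithinAt (s := Ici 0)).congr_deriv ?_ |>.congr_of_mem
    (fun s hs => rieszEnergy_eq hγ c k hs i j) ht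
  -- Differentiating the primitive leaves the energy density conjugated by the flow. In each of its
  -- terms one factor e^{At}e^{-At} collapses to the unit vector e₂, and the other sums to the
  -- response.
  have hinv : ∀ i : Fin 2, (1 : Matrix (Fin 2) (Fin 2) ℝ) i 1 =
      ∑ a, flow c k t i a * flow c k (-t) a 1 := by
    intro i
    rw [← flow_mul_flow_neg c k t, Matrix.mul_apply]
  rw [hinv i, hinv j]
  simp only [rieszEnergy_eq hγ c k ht, rieszResponse_eq hγ, energyDensity, Matrix.mul_apply,
    Fin.sum_univ_two]
  ring

/-- The Lyapunov equation of the covariance, with the memory coefficients as forcing. The derivative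
is taken within [0, ∞) because the primitive formula for the energy holds only there. -/
theorem hasDerivWithinAt_responseCov {H : ℝ} (hH : 1 / 2 < H) (c k σ : ℝ)
    (S₀ : Matrix (Fin 2) (Fin 2) ℝ) {t : ℝ} (ht : 0 ≤ t) (i j : Fin 2) :
    HasDerivWithinAt (fun t => responseCov H c k σ S₀ t i j)
      ((∑ a, driftMatrix c k i a * responseCov H c k σ S₀ t a j) +
        (∑ a, driftMatrix c k j a * responseCov H c k σ S₀ t i a) +
        (memDiffusion H c k σ i 1 t * (1 : Matrix (Fin 2) (Fin 2) ℝ) j 1 +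
          (1 : Matrix (Fin 2) (Fin 2) ℝ) i 1 * memDiffusion H c k σ j 1 t)) (Ici 0) t := by
  have h1 : HasDerivAt (fun t => (flow c k t * S₀ * (flow c k t)ᵀ) i j)
      (∑ b, ∑ a, ((driftMatrix c k * flow c k t) i a * S₀ a b * flow c k t j b +
        flow c k t i a * S₀ a b * (driftMatrix c k * flow c k t) j b)) t := by
    simp only [Matrix.mul_apply (M := _ * S₀), Matrix.mul_apply (N := S₀), Finset.sum_mul,
      transpose_apply]
    refine HasDerivAt.fun_sum fun b _ => HasDerivAt.fun_sum fun a _ => ?_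
    exact ((hasDerivAt_flow' c k t i a).mul_const (S₀ a b)).mul (hasDerivAt_flow' c k t j b)
  have h2 := (hasDerivWithinAt_rieszEnergy (γ := 2 * H - 2) (by linarith) c k ht i j).const_mul
    (H * (2 * H - 1) * σ ^ 2)
  simp only [responseCov_apply]
  refine (h1.hasDerivWithinAt.add h2).congr_deriv ?_
  simp only [memDiffusion_eq, Matrix.mul_apply, Fin.sum_univ_two, transpose_apply]
  ring

end CovarianceDerivative

/-! ### The covariance of fractional Brownian motion and the isometry formula. -/

section FbmKernel

/-- The covariance kernel of fractional Brownian motion. -/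
noncomputable def fbmCov (H u v : ℝ) : ℝ := (u ^ (2 * H) + v ^ (2 * H) - |v - u| ^ (2 * H)) / 2

/-- The partial derivative of `fbmCov` in its second variable. -/
noncomputable def fbmCovDeriv (H u v : ℝ) : ℝ :=
  H * (v ^ (2 * H - 1) - |v - u| ^ (2 * H - 2) * (v - u))

/-- For -1 < γ < 0 the factor |x|^γ is singular at 0, but the product is not: the right-hand side
uses only the exponent γ + 1 > 0, which makes continuity visible. -/
theorem abs_rpow_mul_self_eq {γ : ℝ} (hγ : γ + 1 ≠ 0) (x : ℝ) :
    |x| ^ γ * x = (max x 0) ^ (γ + 1) - (max (-x) 0) ^ (γ + 1) := by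
  rcases lt_trichotomy x 0 with h | rfl | h
  · rw [max_eq_right h.le, max_eq_left (by linarith), abs_of_neg h, Real.zero_rpow hγ,
      Real.rpow_add_one (by linarith)]
    ring
  · simp
  · rw [max_eq_left h.le, max_eq_right (by linarith), abs_of_pos h, Real.zero_rpow hγ,
      Real.rpow_add_one h.ne']
    ring

theorem continuous_abs_rpow_mul_self {γ : ℝ} (hγ : -1 < γ) :
    Continuous fun x : ℝ => |x| ^ γ * x := by
  simp only [abs_rpow_mul_self_eq (show γ + 1 ≠ 0 by linarith)]
  exact ((continuous_id.max continuous_const).rpow_const fun _ => Or.inr (by linarith)).sub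
    ((continuous_neg.max continuous_const).rpow_const fun _ => Or.inr (by linarith))

theorem hasDerivAt_abs_rpow_mul_self (γ : ℝ) {x : ℝ} (hx : x ≠ 0) :
    HasDerivAt (fun x : ℝ => |x| ^ γ * x) ((γ + 1) * |x| ^ γ) x := by
  have h1 := ((hasDerivAt_abs hx).rpow_const (p := γ) (Or.inl (abs_ne_zero.2 hx))).mul
    (hasDerivAt_id x)
  refine h1.congr_deriv ?_
  have h2 : |x| ^ γ = |x| ^ (γ - 1) * |x| := by
    rw [← Real.rpow_add_one (abs_ne_zero.2 hx)]; ring_nf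
  rw [h2]
  simp only [id]
  linear_combination γ * |x| ^ (γ - 1) * sign_mul_self x

variable {H : ℝ}

theorem continuous_fbmCov (hH : 0 < H) : Continuous fun p : ℝ × ℝ => fbmCov H p.1 p.2 := by
  unfold fbmCov
  have h : 0 ≤ 2 * H := by linarith
  exact (((continuous_fst.rpow_const fun _ => Or.inr h).add
    (continuous_snd.rpow_const fun _ => Or.inr h)).sub
    ((continuous_snd.sub continuous_fst).abs.rpow_const fun _ => Or.inr h)).div_const 2

theorem continuous_fbmCovDeriv (hH : 1 / 2 < H) :
    Continuous fun p : ℝ × ℝ => fbmCovDeriv H p.1 p.2 := by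
  unfold fbmCovDeriv
  exact continuous_const.mul ((continuous_snd.rpow_const fun _ => Or.inr (by linarith)).sub
    ((continuous_abs_rpow_mul_self (γ := 2 * H - 2) (by linarith)).comp
      (continuous_snd.sub continuous_fst)))

theorem hasDerivAt_fbmCov (hH : 1 / 2 < H) (u : ℝ) {v : ℝ} (hv : 0 < v) :
    HasDerivAt (fbmCov H u) (fbmCovDeriv H u v) v := by
  have h1 := (hasDerivAt_abs_rpow (v - u) (p := 2 * H) (by linarith)).comp v
    ((hasDerivAt_id v).sub_const u)
  have h2 := Real.hasDerivAt_rpow_const (x := v) (p := 2 * H) (Or.inl hv.ne')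
  refine (((h2.const_add (u ^ (2 * H))).sub h1).div_const 2).congr_deriv ?_
  simp only [fbmCovDeriv]
  ring

theorem hasDerivAt_fbmCovDeriv (H : ℝ) {u v : ℝ} (huv : u ≠ v) :
    HasDerivAt (fun u => fbmCovDeriv H u v) (H * (2 * H - 1) * |u - v| ^ (2 * H - 2)) u := by
  have h1 := (hasDerivAt_abs_rpow_mul_self (2 * H - 2) (x := v - u) (sub_ne_zero.2 huv.symm)).comp u
    ((hasDerivAt_id u).const_sub v)
  refine ((h1.const_sub (v ^ (2 * H - 1))).const_mul H).congr_deriv ?_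
  rw [abs_sub_comm u v]
  ring

theorem fbmCovDeriv_zero (H : ℝ) {v : ℝ} (hv : 0 < v) : fbmCovDeriv H 0 v = 0 := by
  rw [fbmCovDeriv, sub_zero, abs_of_pos hv, ← Real.rpow_add_one hv.ne']
  ring_nf

theorem fbmCov_zero_right (hH : 0 < H) {u : ℝ} (hu : 0 ≤ u) : fbmCov H u 0 = 0 := by
  rw [fbmCov, zero_sub, abs_neg, abs_of_nonneg hu, Real.zero_rpow (by linarith)]
  ring

theorem fbmCov_comm (H u v : ℝ) : fbmCov H u v = fbmCov H v u := by
  rw [fbmCov, fbmCov, abs_sub_comm]; ring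

/-- Covariance of `∫₀ᵗ ψ(t - s) dB(s)`, defined through integration by parts, with `B(u)`. -/
noncomputable def noiseCovFbm (H : ℝ) (ψ ψ' : ℝ → ℝ) (t u : ℝ) : ℝ :=
  ψ 0 * fbmCov H t u + ∫ v in (0 : ℝ)..t, ψ' (t - v) * fbmCov H v u

theorem continuous_noiseCovFbm (hH : 0 < H) (ψ : ℝ → ℝ) {ψ' : ℝ → ℝ} (hψ' : Continuous ψ') (t : ℝ) :
    Continuous (noiseCovFbm H ψ ψ' t) := by
  have hR := continuous_fbmCov hH
  refine (continuous_const.mul (hR.comp (by fun_prop : Continuous fun u : ℝ => (t, u)))).add ?_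
  refine intervalIntegral.continuous_parametric_intervalIntegral_of_continuous' ?_ 0 t
  exact (hψ'.comp (by fun_prop : Continuous fun p : ℝ × ℝ => t - p.2)).mul
    (hR.comp (by fun_prop : Continuous fun p : ℝ × ℝ => (p.2, p.1)))

/-- Integration by parts in `v`. The boundary term at v = 0 vanishes because the covariance with
time 0 does, and the derivative of the kernel is needed only for v > 0. -/
theorem noiseCovFbm_eq (hH : 1 / 2 < H) {ψ ψ' : ℝ → ℝ} (hψ : ∀ x, HasDerivAt ψ (ψ' x) x)
    (hψ' : Continuous ψ') {t u : ℝ} (ht : 0 ≤ t) (hu : 0 ≤ u) :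
    noiseCovFbm H ψ ψ' t u = ∫ v in (0 : ℝ)..t, ψ (t - v) * fbmCovDeriv H u v := by
  have hψc : Continuous ψ := continuous_iff_continuousAt.2 fun x => (hψ x).continuousAt
  have hR := continuous_fbmCov (H := H) (by linarith)
  have hK := continuous_fbmCovDeriv hH
  have hd : ∀ v, HasDerivAt (fun v => ψ (t - v)) (-ψ' (t - v)) v := fun v =>
    (hψ (t - v)).comp_const_sub t v
  have h := intervalIntegral.integral_mul_deriv_eq_deriv_mul_of_hasDerivAt (a := 0) (b := t)
    (u := fun v => ψ (t - v)) (v := fbmCov H u) (u' := fun v => -ψ' (t - v))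
    (v' := fbmCovDeriv H u) (by fun_prop)
    (hR.comp (by fun_prop : Continuous fun v : ℝ => (u, v))).continuousOn
    (fun v _ => hd v) (fun v hv => hasDerivAt_fbmCov hH u (by simpa [ht] using hv.1))
    (by apply Continuous.intervalIntegrable; fun_prop)
    (by
      apply Continuous.intervalIntegrable
      exact hK.comp (by fun_prop : Continuous fun v : ℝ => (u, v)))
  rw [h, fbmCov_zero_right (by linarith) hu]
  simp only [noiseCovFbm, sub_self, mul_zero, sub_zero, neg_mul, intervalIntegral.integral_neg,
    sub_neg_eq_add, fbmCov_comm H u]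

theorem integral_mul_riesz_eq (hH : 1 / 2 < H) {φ φ' : ℝ → ℝ} (hφ : ∀ x, HasDerivAt φ (φ' x) x)
    (hφ' : Continuous φ') {t v : ℝ} (hv : 0 < v) :
    ∫ u in (0 : ℝ)..t, φ (t - u) * (H * (2 * H - 1) * |u - v| ^ (2 * H - 2)) =
      φ 0 * fbmCovDeriv H t v + ∫ u in (0 : ℝ)..t, φ' (t - u) * fbmCovDeriv H u v := by
  have hφc : Continuous φ := continuous_iff_continuousAt.2 fun x => (hφ x).continuousAt
  have hK : Continuous fun u => fbmCovDeriv H u v :=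
    (continuous_fbmCovDeriv hH).comp (by fun_prop : Continuous fun u : ℝ => (u, v))
  have hd : ∀ v, HasDerivAt (fun v => φ (t - v)) (-φ' (t - v)) v := fun v =>
    (hφ (t - v)).comp_const_sub t v
  have i1 : IntervalIntegrable (fun u => -φ' (t - u) * fbmCovDeriv H u v) volume 0 t := by
    apply Continuous.intervalIntegrable; fun_prop
  have i2 : IntervalIntegrable
      (fun u => φ (t - u) * (H * (2 * H - 1) * |u - v| ^ (2 * H - 2))) volume 0 t := by
    simp only [abs_sub_comm _ v]
    exact ((intervalIntegrable_abs_sub_rpow (by linarith) v 0 t).const_mul _).continuousOn_mul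
      (by fun_prop)
  -- The primitive is continuous everywhere and fails to have the stated derivative at most at u =
  -- v, so the fundamental theorem with a countable exceptional set applies. The boundary term at u
  -- = 0 vanishes by `fbmCovDeriv_zero`.
  have h := integral_eq_of_hasDerivAt_off_countable (a := 0) (b := t)
    (fun u => φ (t - u) * fbmCovDeriv H u v)
    (fun u => -φ' (t - u) * fbmCovDeriv H u v +
      φ (t - u) * (H * (2 * H - 1) * |u - v| ^ (2 * H - 2)))
    (countable_singleton v) (by fun_prop)
    (fun u hu => (hd u).mul (hasDerivAt_fbmCovDeriv H hu.2)) (i1.add i2)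
  rw [intervalIntegral.integral_add i1 i2, fbmCovDeriv_zero H hv] at h
  simp only [neg_mul, intervalIntegral.integral_neg, sub_self, mul_zero, sub_zero] at h
  linarith

/-- The isometry formula: the energy with respect to the Riesz kernel is the covariance of the
integrals defined through integration by parts. -/
theorem integral_integral_riesz_eq_noiseCov (hH : 1 / 2 < H) {φ φ' ψ ψ' : ℝ → ℝ}
    (hφ : ∀ x, HasDerivAt φ (φ' x) x) (hφ' : Continuous φ')
    (hψ : ∀ x, HasDerivAt ψ (ψ' x) x) (hψ' : Continuous ψ') {t : ℝ} (ht : 0 ≤ t) :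
    H * (2 * H - 1) * ∫ v in (0 : ℝ)..t, ∫ u in (0 : ℝ)..t,
        φ (t - u) * ψ (t - v) * |u - v| ^ (2 * H - 2) =
      φ 0 * noiseCovFbm H ψ ψ' t t +
        ∫ u in (0 : ℝ)..t, φ' (t - u) * noiseCovFbm H ψ ψ' t u := by
  have hψc : Continuous ψ := continuous_iff_continuousAt.2 fun x => (hψ x).continuousAt
  have hK := continuous_fbmCovDeriv hH
  have e1 : H * (2 * H - 1) * ∫ v in (0 : ℝ)..t, ∫ u in (0 : ℝ)..t,
        φ (t - u) * ψ (t - v) * |u - v| ^ (2 * H - 2) =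
      ∫ v in (0 : ℝ)..t, (φ 0 * (ψ (t - v) * fbmCovDeriv H t v) +
        ∫ u in (0 : ℝ)..t, φ' (t - u) * (ψ (t - v) * fbmCovDeriv H u v)) := by
    rw [← intervalIntegral.integral_const_mul, intervalIntegral.integral_of_le ht,
      intervalIntegral.integral_of_le ht]
    -- The half-open interval excludes v = 0, where the inner integration by parts is not available.
    refine setIntegral_congr_fun measurableSet_Ioc fun v hv => ?_
    have h := congrArg (fun x => ψ (t - v) * x) (integral_mul_riesz_eq (t := t) hH hφ hφ' hv.1)
    simp only [mul_add, ← intervalIntegral.integral_const_mul] at h ⊢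
    convert! h using 2
    · ext u; ring
    · ring
    · congr 1; ext u; ring
  have hcont : Continuous fun p : ℝ × ℝ =>
      φ' (t - p.2) * (ψ (t - p.1) * fbmCovDeriv H p.2 p.1) :=
    (hφ'.comp (by fun_prop)).mul ((hψc.comp (by fun_prop)).mul
      (hK.comp (by fun_prop : Continuous fun p : ℝ × ℝ => (p.2, p.1))))
  have hcu : ∀ u, Continuous fun v => ψ (t - v) * fbmCovDeriv H u v := fun u =>
    (hψc.comp (by fun_prop)).mul (hK.comp (by fun_prop : Continuous fun v : ℝ => (u, v)))
  have hswap : ∫ v in (0 : ℝ)..t, ∫ u in (0 : ℝ)..t, φ' (t - u) * (ψ (t - v) * fbmCovDeriv H u v) =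
      ∫ u in (0 : ℝ)..t, ∫ v in (0 : ℝ)..t, φ' (t - u) * (ψ (t - v) * fbmCovDeriv H u v) := by
    simp only [intervalIntegral.integral_of_le ht]
    refine integral_integral_swap ?_
    rw [Measure.prod_restrict]
    exact (hcont.continuousOn.integrableOn_compact (isCompact_Icc.prod isCompact_Icc)).mono_set
      (prod_mono Ioc_subset_Icc_self Ioc_subset_Icc_self)
  rw [e1, intervalIntegral.integral_add, hswap]
  · congr 1
    · rw [intervalIntegral.integral_const_mul, noiseCovFbm_eq hH hψ hψ' ht ht]
    · refine intervalIntegral.integral_congr fun u hu => ?_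
      rw [uIcc_of_le ht] at hu
      simp only [intervalIntegral.integral_const_mul]
      rw [noiseCovFbm_eq hH hψ hψ' ht hu.1]
  · exact ((hcu t).const_mul _).intervalIntegrable _ _
  · exact (intervalIntegral.continuous_parametric_intervalIntegral_of_continuous' hcont 0 t).intervalIntegrable _ _

end FbmKernel

/-! ### Almost sure limits of centred Gaussian families and covariances of path integrals. -/

section GaussianLimit

open Filter Topology

variable {Ω : Type*} [MeasurableSpace Ω] {P : Measure Ω}

theorem charFun_map_of_centred {Y : Ω → ℝ} (hY : HasGaussianLaw Y P) (h0 : ∫ ω, Y ω ∂P = 0)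
    (s : ℝ) : charFun (P.map Y) s = ((Real.exp (-(Var[Y; P] * s ^ 2 / 2)) : ℝ) : ℂ) := by
  rw [hY.map_eq_gaussianReal, h0, charFun_gaussianReal, Real.coe_toNNReal _ (variance_nonneg _ _)]
  push_cast
  congr 1
  ring

theorem tendsto_charFun_map [IsProbabilityMeasure P] {Y : ℕ → Ω → ℝ} {Z : Ω → ℝ} (hY : ∀ n, AEMeasurable (Y n) P)
    (hlim : ∀ᵐ ω ∂P, Tendsto (fun n => Y n ω) atTop (𝓝 (Z ω))) (s : ℝ) :
    Tendsto (fun n => charFun (P.map (Y n)) s) atTop (𝓝 (charFun (P.map Z) s)) := by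
  have hZ : AEMeasurable Z P := aemeasurable_of_tendsto_metrizable_ae' hY hlim
  have h : ∀ {U : Ω → ℝ}, AEMeasurable U P →
      charFun (P.map U) s = ∫ ω, Complex.exp (s * U ω * Complex.I) ∂P := by
    intro U hU
    rw [charFun_apply_real, integral_map hU (by fun_prop)]
  simp only [h (hY _), h hZ]
  refine tendsto_integral_of_dominated_convergence (fun _ => 1) (fun n => ?_)
    (integrable_const _) (fun n => ae_of_all _ fun ω => ?_) ?_
  · have := hY n
    exact AEMeasurable.aestronglyMeasurable (by fun_prop)
  · rw [← Complex.ofReal_mul, Complex.norm_exp_ofReal_mul_I]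
  · filter_upwards [hlim] with ω hω
    have hc : Continuous fun x : ℝ => Complex.exp (s * x * Complex.I) := by fun_prop
    exact (hc.tendsto (Z ω)).comp hω

/-- An almost sure limit of centred Gaussian variables is a centred Gaussian variable, and the
variances converge. -/
theorem hasGaussianLaw_of_tendsto [IsProbabilityMeasure P] {Y : ℕ → Ω → ℝ} {Z : Ω → ℝ} (hY : ∀ n, HasGaussianLaw (Y n) P)
    (h0 : ∀ n, ∫ ω, Y n ω ∂P = 0)
    (hlim : ∀ᵐ ω ∂P, Tendsto (fun n => Y n ω) atTop (𝓝 (Z ω))) :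
    HasGaussianLaw Z P ∧ ∫ ω, Z ω ∂P = 0 ∧
      Tendsto (fun n => Var[Y n; P]) atTop (𝓝 Var[Z; P]) := by
  have hZ : AEMeasurable Z P :=
    aemeasurable_of_tendsto_metrizable_ae' (fun n => (hY n).aemeasurable) hlim
  have : IsProbabilityMeasure (P.map Z) := Measure.isProbabilityMeasure_map hZ
  have hφ := tendsto_charFun_map (fun n => (hY n).aemeasurable) hlim
  simp only [charFun_map_of_centred (hY _) (h0 _)] at hφ
  set r : ℝ → ℝ := fun s => (charFun (P.map Z) s).re with hr
  have hφr : ∀ s, Tendsto (fun n => Real.exp (-(Var[Y n; P] * s ^ 2 / 2))) atTop (𝓝 (r s)) := by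
    intro s
    have := (Complex.continuous_re.tendsto _).comp (hφ s)
    simpa [Function.comp_def, -Complex.ofReal_exp] using this
  have hrc : Continuous r := Complex.continuous_re.comp continuous_charFun
  have hr0 : r 0 = 1 := by simp [hr]
  -- The limiting characteristic function is continuous with value 1 at 0, hence positive at some s
  -- ≠ 0. Taking logarithms there recovers the variances and forces them to converge, with no
  -- uniform integrability argument.
  obtain ⟨s, hs0, hs⟩ : ∃ s : ℝ, s ≠ 0 ∧ 0 < r s := by
    have h1 : ∀ᶠ s in 𝓝 (0 : ℝ), 0 < r s :=
      hrc.continuousAt.eventually_const_lt (by simp [hr0])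
    obtain ⟨s, hs, hs'⟩ := ((h1.filter_mono nhdsWithin_le_nhds).and
      (self_mem_nhdsWithin (a := (0 : ℝ)) (s := {0}ᶜ))).exists
    exact ⟨s, hs', hs⟩
  have hvar : Tendsto (fun n => Var[Y n; P]) atTop (𝓝 (-(2 * Real.log (r s)) / s ^ 2)) := by
    have h1 := ((hφr s).log hs.ne').const_mul 2 |>.neg |>.div_const (s ^ 2)
    refine h1.congr fun n => ?_
    rw [Real.log_exp]
    field_simp
  set v := -(2 * Real.log (r s)) / s ^ 2
  have hv : 0 ≤ v := ge_of_tendsto' hvar fun n => variance_nonneg _ _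
  have hmap : P.map Z = gaussianReal 0 v.toNNReal := by
    refine Measure.ext_of_charFun (funext fun s => tendsto_nhds_unique (hφ s) ?_)
    have h1 : Continuous fun v : ℝ => ((Real.exp (-(v * s ^ 2 / 2)) : ℝ) : ℂ) := by fun_prop
    have h2 := (h1.tendsto v).comp hvar
    convert! h2 using 2
    rw [charFun_gaussianReal, Real.coe_toNNReal _ hv]
    push_cast
    congr 1
    ring
  have hlaw : HasLaw Z (gaussianReal 0 v.toNNReal) P := ⟨hZ, hmap⟩
  refine ⟨hlaw.hasGaussianLaw, ?_, ?_⟩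
  · rw [hlaw.integral_eq]; simp
  · rw [hlaw.variance_eq]
    simpa [hv] using hvar

variable {T : Type*}

/-- Finite linear combinations of `W` are centred Gaussian variables. -/
def IsCentredGaussianFamily (W : T → Ω → ℝ) (P : Measure Ω) : Prop :=
  ∀ Y ∈ Submodule.span ℝ (range W), HasGaussianLaw Y P ∧ ∫ ω, Y ω ∂P = 0

/-- Almost sure limits of finite linear combinations of `W`. -/
def gaussianClosure (W : T → Ω → ℝ) (P : Measure Ω) : Submodule ℝ (Ω → ℝ) where
  carrier := {Z | ∃ Y : ℕ → Ω → ℝ, (∀ n, Y n ∈ Submodule.span ℝ (range W)) ∧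
    ∀ᵐ ω ∂P, Tendsto (fun n => Y n ω) atTop (𝓝 (Z ω))}
  zero_mem' := ⟨fun _ => 0, fun _ => zero_mem _, by simp⟩
  add_mem' := by
    rintro Z Z' ⟨Y, hY, hl⟩ ⟨Y', hY', hl'⟩
    refine ⟨fun n => Y n + Y' n, fun n => add_mem (hY n) (hY' n), ?_⟩
    filter_upwards [hl, hl'] with ω h h' using h.add h'
  smul_mem' := by
    rintro c Z ⟨Y, hY, hl⟩
    refine ⟨fun n => c • Y n, fun n => Submodule.smul_mem _ _ (hY n), ?_⟩
    filter_upwards [hl] with ω h using h.const_mul c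

variable {W : T → Ω → ℝ}

theorem span_le_gaussianClosure : Submodule.span ℝ (range W) ≤ gaussianClosure W P :=
  fun Y hY => ⟨fun _ => Y, fun _ => hY, ae_of_all _ fun _ => tendsto_const_nhds⟩

theorem apply_mem_gaussianClosure (t : T) : W t ∈ gaussianClosure W P :=
  span_le_gaussianClosure (Submodule.subset_span (mem_range_self t))

namespace IsCentredGaussianFamily

theorem closure [IsProbabilityMeasure P] (hW : IsCentredGaussianFamily W P) {Z : Ω → ℝ} (hZ : Z ∈ gaussianClosure W P) :
    HasGaussianLaw Z P ∧ ∫ ω, Z ω ∂P = 0 := by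
  obtain ⟨Y, hY, hl⟩ := hZ
  have h := hasGaussianLaw_of_tendsto (fun n => (hW _ (hY n)).1) (fun n => (hW _ (hY n)).2) hl
  exact ⟨h.1, h.2.1⟩

theorem memLp [IsProbabilityMeasure P] (hW : IsCentredGaussianFamily W P) {Z : Ω → ℝ} (hZ : Z ∈ gaussianClosure W P) :
    MemLp Z 2 P := (hW.closure hZ).1.memLp_two

theorem tendsto_covariance [IsProbabilityMeasure P] (hW : IsCentredGaussianFamily W P) {Y : ℕ → Ω → ℝ} {Z U : Ω → ℝ}
    (hY : ∀ n, Y n ∈ gaussianClosure W P) (hZ : Z ∈ gaussianClosure W P)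
    (hU : U ∈ gaussianClosure W P)
    (hlim : ∀ᵐ ω ∂P, Tendsto (fun n => Y n ω) atTop (𝓝 (Z ω))) :
    Tendsto (fun n => cov[Y n, U; P]) atTop (𝓝 cov[Z, U; P]) := by
  -- Polarisation reduces convergence of covariances to convergence of variances, applied to the
  -- sequence and to its translate by `U`.
  have key : ∀ {A : Ω → ℝ}, A ∈ gaussianClosure W P →
      cov[A, U; P] = (Var[A + U; P] - Var[A; P] - Var[U; P]) / 2 := by
    intro A hA
    rw [variance_add (hW.memLp hA) (hW.memLp hU)]
    ring
  simp only [key (hY _), key hZ]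
  have h1 := hasGaussianLaw_of_tendsto (fun n => (hW.closure (hY n)).1)
    (fun n => (hW.closure (hY n)).2) hlim
  have h2 := hasGaussianLaw_of_tendsto (Y := fun n => Y n + U) (Z := Z + U)
    (fun n => (hW.closure (add_mem (hY n) hU)).1) (fun n => (hW.closure (add_mem (hY n) hU)).2)
    (by filter_upwards [hlim] with ω h using h.add_const _)
  exact ((h2.2.2.sub h1.2.2).sub_const _).div_const 2

end IsCentredGaussianFamily

theorem tendsto_riemann_sum {f : ℝ → ℝ} (hf : Continuous f) {T : ℝ} (hT : 0 ≤ T) :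
    Tendsto (fun n : ℕ => ∑ k ∈ Finset.range n, T / n * f (k * (T / n))) atTop
      (𝓝 (∫ s in (0 : ℝ)..T, f s)) := by
  have huc := (isCompact_Icc (a := (0 : ℝ)) (b := T)).uniformContinuousOn_of_continuous
    hf.continuousOn
  rw [Metric.tendsto_atTop]
  intro ε hε
  -- Dividing by T + 1 instead of T covers T = 0 and gives a total error strictly below ε.
  obtain ⟨δ, hδ, hfδ⟩ := Metric.uniformContinuousOn_iff.1 huc (ε / (T + 1)) (by positivity)
  obtain ⟨N, hN⟩ := exists_nat_gt (T / δ)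
  refine ⟨N + 1, fun n hn => ?_⟩
  have hn0 : (0 : ℝ) < n := by exact_mod_cast (by omega : 0 < n)
  have hstep : T / n < δ := by
    rw [div_lt_iff₀ hn0]
    rw [div_lt_iff₀ hδ] at hN
    have : (N : ℝ) ≤ n := by exact_mod_cast (by omega : N ≤ n)
    nlinarith
  have hh : 0 ≤ T / n := by positivity
  have hsum : ∑ k ∈ Finset.range n, ∫ s in (k * (T / n))..((k + 1 : ℕ) * (T / n)), f s =
      ∫ s in (0 : ℝ)..T, f s := by
    rw [intervalIntegral.sum_integral_adjacent_intervals (a := fun k : ℕ => k * (T / n))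
      (fun k _ => hf.intervalIntegrable _ _)]
    congr 1
    · simp
    · field_simp
  rw [dist_eq_norm, ← hsum, ← Finset.sum_sub_distrib]
  have hle : ∀ k ∈ Finset.range n, ‖T / n * f (k * (T / n)) -
      ∫ s in (k * (T / n))..((k + 1 : ℕ) * (T / n)), f s‖ ≤ ε / (T + 1) * (T / n) := by
    intro k hk
    have hk' : ((k + 1 : ℕ) : ℝ) ≤ n := by exact_mod_cast Finset.mem_range.1 hk
    have hkk : (k : ℝ) * (T / n) ≤ (k + 1 : ℕ) * (T / n) := by
      push_cast; nlinarith
    have hkT : ((k + 1 : ℕ) : ℝ) * (T / n) ≤ T := by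
      calc ((k + 1 : ℕ) : ℝ) * (T / n) ≤ n * (T / n) := by gcongr
        _ = T := by field_simp
    have hk0 : 0 ≤ (k : ℝ) * (T / n) := by positivity
    have h1 : T / n * f (k * (T / n)) =
        ∫ s in (k * (T / n))..((k + 1 : ℕ) * (T / n)), f (k * (T / n)) := by
      rw [intervalIntegral.integral_const, smul_eq_mul]
      push_cast
      ring
    rw [h1, ← intervalIntegral.integral_sub (intervalIntegrable_const)
      (hf.intervalIntegrable _ _)]
    refine (intervalIntegral.norm_integral_le_of_norm_le_const (C := ε / (T + 1)) ?_).trans ?_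
    · intro s hs
      rw [uIoc_of_le hkk] at hs
      rw [← dist_eq_norm]
      refine (hfδ _ ⟨hk0, hkk.trans hkT⟩ _ ⟨hk0.trans hs.1.le, hs.2.trans hkT⟩ ?_).le
      rw [Real.dist_eq, abs_sub_comm, abs_of_nonneg (by linarith [hs.1])]
      have := hs.2
      push_cast at this
      linarith
    · rw [abs_of_nonneg (by linarith)]
      push_cast
      apply le_of_eq
      ring
  calc _ ≤ ∑ k ∈ Finset.range n, ε / (T + 1) * (T / n) :=
        (norm_sum_le _ _).trans (Finset.sum_le_sum hle)
    _ = ε * (T / (T + 1)) := by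
        rw [Finset.sum_const, Finset.card_range, nsmul_eq_mul]; field_simp
    _ < ε := by
        have : T / (T + 1) < 1 := by rw [div_lt_one (by linarith)]; linarith
        nlinarith

/-- Weighted time integrals of a process with continuous paths stay in the Gaussian closure. -/
theorem integral_mem_gaussianClosure {b : ℝ≥0 → Ω → ℝ} (hb : ∀ t, b t ∈ Submodule.span ℝ (range W))
    (hcont : ∀ᵐ ω ∂P, Continuous fun t => b t ω) {f : ℝ → ℝ} (hf : Continuous f) {T : ℝ}
    (hT : 0 ≤ T) : (fun ω => ∫ s in (0 : ℝ)..T, f s * b s.toNNReal ω) ∈ gaussianClosure W P := by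
  refine ⟨fun n => ∑ k ∈ Finset.range n,
    (T / n * f (k * (T / n))) • b (k * (T / n) : ℝ).toNNReal,
    fun n => sum_mem fun k _ => Submodule.smul_mem _ _ (hb _), ?_⟩
  filter_upwards [hcont] with ω hω
  have h := tendsto_riemann_sum (hf.mul (hω.comp continuous_real_toNNReal)) hT
  refine h.congr fun n => ?_
  rw [Finset.sum_apply]
  simp [mul_assoc]

/-- The same Riemann sums approximate the path integral almost surely and the integral of the
covariances; `tendsto_covariance` identifies the two limits without a Fubini argument on Ω. -/
theorem covariance_integral_left [IsProbabilityMeasure P] (hW : IsCentredGaussianFamily W P) {b : ℝ≥0 → Ω → ℝ}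
    (hb : ∀ t, b t ∈ Submodule.span ℝ (range W))
    (hcont : ∀ᵐ ω ∂P, Continuous fun t => b t ω) {f : ℝ → ℝ} (hf : Continuous f) {T : ℝ}
    (hT : 0 ≤ T) {U : Ω → ℝ} (hU : U ∈ gaussianClosure W P) {K : ℝ → ℝ} (hK : Continuous K)
    (hKU : ∀ s : ℝ, 0 ≤ s → cov[b s.toNNReal, U; P] = K s) :
    cov[fun ω => ∫ s in (0 : ℝ)..T, f s * b s.toNNReal ω, U; P] =
      ∫ s in (0 : ℝ)..T, f s * K s := by
  set Y : ℕ → Ω → ℝ := fun n => ∑ k ∈ Finset.range n,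
    (T / n * f (k * (T / n))) • b (k * (T / n) : ℝ).toNNReal with hYdef
  have hY : ∀ n, Y n ∈ gaussianClosure W P := fun n => span_le_gaussianClosure
    (sum_mem fun k _ => Submodule.smul_mem _ _ (hb _))
  have hlim : ∀ᵐ ω ∂P, Tendsto (fun n => Y n ω) atTop
      (𝓝 (∫ s in (0 : ℝ)..T, f s * b s.toNNReal ω)) := by
    filter_upwards [hcont] with ω hω
    have h := tendsto_riemann_sum (hf.mul (hω.comp continuous_real_toNNReal)) hT
    refine h.congr fun n => ?_
    simp [hYdef, mul_assoc]
  refine tendsto_nhds_unique (hW.tendsto_covariance hY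
    (integral_mem_gaussianClosure hb hcont hf hT) hU hlim) ?_
  refine (tendsto_riemann_sum (hf.mul hK) hT).congr fun n => ?_
  rw [hYdef, covariance_sum_left' (fun k _ => (hW.memLp
    (span_le_gaussianClosure (hb _))).const_smul _) (hW.memLp hU)]
  refine Finset.sum_congr rfl fun k _ => ?_
  rw [covariance_smul_left, hKU _ (by positivity), Pi.mul_apply, mul_assoc]

end GaussianLimit

/-! ### The bivariate Gaussian density. -/

section Density

theorem gaussianDensity_fin_two (m : Fin 2 → ℝ) {S : Matrix (Fin 2) (Fin 2) ℝ}
    (hS : S 1 0 = S 0 1) (x v : ℝ) :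
    gaussianDensity m S ![x, v] = 1 / (2 * Real.pi * √(S 0 0 * S 1 1 - S 0 1 ^ 2)) *
      Real.exp (-(S 1 1 * (x - m 0) ^ 2 - 2 * S 0 1 * (x - m 0) * (v - m 1) +
        S 0 0 * (v - m 1) ^ 2) / (2 * (S 0 0 * S 1 1 - S 0 1 ^ 2))) := by
  have hdet : S.det = S 0 0 * S 1 1 - S 0 1 ^ 2 := by rw [det_fin_two, hS]; ring
  have hquad : -(1 / 2) * ((![x, v] - m) ⬝ᵥ (S⁻¹ *ᵥ (![x, v] - m))) =
      -(S 1 1 * (x - m 0) ^ 2 - 2 * S 0 1 * (x - m 0) * (v - m 1) +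
        S 0 0 * (v - m 1) ^ 2) / (2 * (S 0 0 * S 1 1 - S 0 1 ^ 2)) := by
    rw [Matrix.inv_def, Ring.inverse_eq_inv', hdet, adjugate_fin_two]
    simp only [dotProduct, mulVec, Fin.sum_univ_two, Matrix.smul_apply, Pi.sub_apply, smul_eq_mul]
    simp only [of_apply, cons_val', cons_val_zero, cons_val_one, cons_val_fin_one, hS]
    generalize S 0 0 * S 1 1 - S 0 1 ^ 2 = D
    ring
  rw [gaussianDensity, hquad, hdet]

/-- Completing the square in `v`: the marginal density of the first coordinate times the density of
the regression residual, whose variance is the Schur complement det S / S₀₀. -/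
theorem gaussianDensity_eq_mul (m : Fin 2 → ℝ) {S : Matrix (Fin 2) (Fin 2) ℝ}
    (hS : S.PosDef) (x v : ℝ) :
    gaussianDensity m S ![x, v] = gaussianPDFReal (m 0) (S 0 0).toNNReal x *
      gaussianPDFReal (m 1 - S 0 1 / S 0 0 * m 0) (S.det / S 0 0).toNNReal
        (v - S 0 1 / S 0 0 * x) := by
  have ha : 0 < S 0 0 := hS.diag_pos
  have hd : 0 < S.det := hS.det_pos
  have hsymm : S 1 0 = S 0 1 := by simpa using hS.isHermitian.apply 0 1
  have hdet : S.det = S 0 0 * S 1 1 - S 0 1 ^ 2 := by rw [det_fin_two, hsymm]; ring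
  rw [gaussianDensity_fin_two m hsymm, gaussianPDFReal, gaussianPDFReal,
    Real.coe_toNNReal _ ha.le, Real.coe_toNNReal _ (div_pos hd ha).le, ← hdet]
  rw [mul_mul_mul_comm, ← Real.exp_add, ← mul_inv, ← Real.sqrt_mul (by positivity), one_div]
  congr 2
  · rw [← Real.sqrt_sq (show 0 ≤ 2 * Real.pi by positivity), ← Real.sqrt_mul (by positivity),
      Real.sqrt_sq (by positivity)]
    congr 1
    field_simp
  · field_simp
    rw [hdet]
    ring

theorem gaussianDensity_nonneg (m : Fin 2 → ℝ) (S : Matrix (Fin 2) (Fin 2) ℝ) (x : Fin 2 → ℝ) :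
    0 ≤ gaussianDensity m S x := by
  unfold gaussianDensity
  positivity

theorem measurePreserving_shear (β : ℝ) :
    MeasurePreserving (fun z : ℝ × ℝ => (z.1, z.2 + β * z.1)) volume volume := by
  refine (MeasurePreserving.id volume).skew_product (g := fun x u => u + β * x)
    (by fun_prop) (ae_of_all _ fun x => ?_)
  exact (measurePreserving_add_right volume (β * x)).map_eq

/-- The bivariate Gaussian density is the law of a sheared pair of independent Gaussians. -/
theorem withDensity_gaussianDensity (m : Fin 2 → ℝ) {S : Matrix (Fin 2) (Fin 2) ℝ}
    (hS : S.PosDef) :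
    ((volume : Measure (ℝ × ℝ)).withDensity fun z =>
        ENNReal.ofReal (gaussianDensity m S ![z.1, z.2])) =
      ((gaussianReal (m 0) (S 0 0).toNNReal).prod
        (gaussianReal (m 1 - S 0 1 / S 0 0 * m 0) (S.det / S 0 0).toNNReal)).map
        (fun z : ℝ × ℝ => (z.1, z.2 + S 0 1 / S 0 0 * z.1)) := by
  have ha : 0 < S 0 0 := hS.diag_pos
  have hd : 0 < S.det := hS.det_pos
  have hmp := measurePreserving_shear (S 0 1 / S 0 0)
  have hf : Measurable fun z : ℝ × ℝ => ENNReal.ofReal (gaussianDensity m S ![z.1, z.2]) := by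
    simp only [gaussianDensity_eq_mul m hS]
    have h1 := measurable_gaussianPDFReal (m 0) (S 0 0).toNNReal
    have h2 := measurable_gaussianPDFReal (m 1 - S 0 1 / S 0 0 * m 0) (S.det / S 0 0).toNNReal
    fun_prop
  rw [gaussianReal_of_var_ne_zero _ (by simpa using ha),
    gaussianReal_of_var_ne_zero _ (by simpa using div_pos hd ha),
    prod_withDensity (measurable_gaussianPDF _ _) (measurable_gaussianPDF _ _)]
  ext s hs
  rw [Measure.map_apply hmp.measurable hs, withDensity_apply _ hs,
    withDensity_apply _ (hmp.measurable hs), ← hmp.setLIntegral_comp_preimage hs hf]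
  refine lintegral_congr fun z => ?_
  simp only [gaussianDensity_eq_mul m hS, gaussianPDF, add_sub_cancel_right]
  rw [ENNReal.ofReal_mul (gaussianPDFReal_nonneg _ _ _)]

variable {Ω : Type*} [MeasurableSpace Ω] {P : Measure Ω}

/-- A nondegenerate Gaussian pair has the bivariate Gaussian density. -/
theorem isJointPDF_of_hasGaussianLaw {X V : Ω → ℝ} (hXV : HasGaussianLaw (fun ω => (X ω, V ω)) P)
    {m : Fin 2 → ℝ} {S : Matrix (Fin 2) (Fin 2) ℝ} (hS : S.PosDef)
    (hm : ∀ i, ∫ ω, ![X ω, V ω] i ∂P = m i)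
    (hcov : ∀ i j, cov[fun ω => ![X ω, V ω] i, fun ω => ![X ω, V ω] j; P] = S i j) :
    IsJointPDF X V P fun x v => gaussianDensity m S ![x, v] := by
  have := hXV.isProbabilityMeasure
  have ha : 0 < S 0 0 := hS.diag_pos
  have hX := hXV.fst
  have hV := hXV.snd
  refine ⟨hX.aemeasurable, hV.aemeasurable, fun x v => gaussianDensity_nonneg _ _ _, ?_⟩
  -- The regression coefficient: V - βX is uncorrelated with X, hence independent of it by joint
  -- Gaussianity. The shear then carries the product law back to the law of (X, V).
  set β := S 0 1 / S 0 0 with hβ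
  have hm0 : ∫ ω, X ω ∂P = m 0 := by simpa using hm 0
  have hm1 : ∫ ω, V ω ∂P = m 1 := by simpa using hm 1
  have h00 : cov[X, X; P] = S 0 0 := by simpa using hcov 0 0
  have h01 : cov[X, V; P] = S 0 1 := by simpa using hcov 0 1
  have h10 : cov[V, X; P] = S 1 0 := by simpa using hcov 1 0
  have h11 : cov[V, V; P] = S 1 1 := by simpa using hcov 1 1
  have hU : HasGaussianLaw (V - β • X) P := by
    have := hXV.map (ContinuousLinearMap.snd ℝ ℝ ℝ - β • ContinuousLinearMap.fst ℝ ℝ ℝ)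
    exact this
  have hXU : HasGaussianLaw (fun ω => (X ω, (V - β • X) ω)) P := by
    have := hXV.map ((ContinuousLinearMap.fst ℝ ℝ ℝ).prod
      (ContinuousLinearMap.snd ℝ ℝ ℝ - β • ContinuousLinearMap.fst ℝ ℝ ℝ))
    exact this
  have hcXU : cov[X, V - β • X; P] = 0 := by
    rw [covariance_sub_right hX.memLp_two hV.memLp_two (hX.memLp_two.const_smul β),
      covariance_smul_right, h00, h01, hβ]
    field_simp
    simp
  have hind := hXU.indepFun_of_covariance_eq_zero hcXU
  have hmU : ∫ ω, (V - β • X) ω ∂P = m 1 - β * m 0 := by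
    simp only [Pi.sub_apply, Pi.smul_apply, smul_eq_mul]
    rw [integral_sub hV.integrable (hX.integrable.const_mul β), integral_const_mul, hm0, hm1]
  have hvU : Var[V - β • X; P] = S.det / S 0 0 := by
    rw [← covariance_self hU.aemeasurable,
      covariance_sub_left hV.memLp_two (hX.memLp_two.const_smul β) hU.memLp_two,
      covariance_smul_left, hcXU,
      covariance_sub_right hV.memLp_two hV.memLp_two (hX.memLp_two.const_smul β),
      covariance_smul_right, h11, h10, det_fin_two, hβ]
    field_simp
    simp
  have hlaw : P.map (fun ω => (X ω, (V - β • X) ω)) = (gaussianReal (m 0) (S 0 0).toNNReal).prod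
        (gaussianReal (m 1 - β * m 0) (S.det / S 0 0).toNNReal) := by
    rw [(indepFun_iff_map_prod_eq_prod_map_map hX.aemeasurable hU.aemeasurable).1 hind,
      hX.map_eq_gaussianReal, hU.map_eq_gaussianReal, hmU, hvU, hm0,
      ← covariance_self hX.aemeasurable, h00]
  rw [withDensity_gaussianDensity m hS, ← hlaw, AEMeasurable.map_map_of_aemeasurable
    (measurePreserving_shear β).measurable.aemeasurable hXU.aemeasurable]
  congr 1
  ext ω <;> simp

/-- A pair with an isotropic Gaussian density consists of independent Gaussian variables. -/
theorem IsJointPDF.of_isotropic [IsProbabilityMeasure P] {X V : Ω → ℝ} {m : Fin 2 → ℝ} {s : ℝ}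
    (hs : 0 < s) (h : IsJointPDF X V P fun x v =>
      gaussianDensity m (s ^ 2 • (1 : Matrix (Fin 2) (Fin 2) ℝ)) ![x, v]) :
    IndepFun X V P ∧ P.map X = gaussianReal (m 0) (s ^ 2).toNNReal ∧
      P.map V = gaussianReal (m 1) (s ^ 2).toNNReal := by
  obtain ⟨hX, hV, -, hmap⟩ := h
  have hS : (s ^ 2 • (1 : Matrix (Fin 2) (Fin 2) ℝ)).PosDef := PosDef.one.smul (by positivity)
  rw [withDensity_gaussianDensity m hS] at hmap
  have hdet : (s ^ 2 • (1 : Matrix (Fin 2) (Fin 2) ℝ)).det = s ^ 2 * s ^ 2 := by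
    simp
    ring
  rw [hdet] at hmap
  have hs2 : s ^ 2 * s ^ 2 / s ^ 2 = s ^ 2 := by field_simp
  simp only [Matrix.smul_apply, Matrix.one_apply_eq, ne_eq, zero_ne_one, not_false_eq_true,
    Matrix.one_apply_ne, smul_eq_mul, mul_one, mul_zero, zero_div, zero_mul, sub_zero,
    add_zero, Prod.mk.eta, Measure.map_id', hs2] at hmap
  have h1 : P.map X = gaussianReal (m 0) (s ^ 2).toNNReal := by
    have := congrArg (Measure.map Prod.fst) hmap
    rw [AEMeasurable.map_map_of_aemeasurable measurable_fst.aemeasurable (hX.prodMk hV)] at this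
    simpa [Function.comp_def, Measure.map_fst_prod] using this
  have h2 : P.map V = gaussianReal (m 1) (s ^ 2).toNNReal := by
    have := congrArg (Measure.map Prod.snd) hmap
    rw [AEMeasurable.map_map_of_aemeasurable measurable_snd.aemeasurable (hX.prodMk hV)] at this
    simpa [Function.comp_def, Measure.map_snd_prod] using this
  exact ⟨(indepFun_iff_map_prod_eq_prod_map_map hX hV).2 (by rw [hmap, h1, h2]), h1, h2⟩

theorem contDiff_gaussianDensity (m : Fin 2 → ℝ) {S : Matrix (Fin 2) (Fin 2) ℝ}
    (hS : S 1 0 = S 0 1) :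
    ContDiff ℝ (⊤ : ℕ∞) fun z : ℝ × ℝ => gaussianDensity m S ![z.1, z.2] := by
  simp only [gaussianDensity_fin_two m hS]
  fun_prop

end Density

/-! ### From the moment equations to the memFPK equation. -/

section FokkerPlanck

theorem hasDerivAt_bivariate_fst (m₀ m₁ a b d D C x v : ℝ) :
    HasDerivAt (fun x => C * Real.exp (-(d * (x - m₀) ^ 2 - 2 * b * (x - m₀) * (v - m₁) +
        a * (v - m₁) ^ 2) / (2 * D)))
      (C * Real.exp (-(d * (x - m₀) ^ 2 - 2 * b * (x - m₀) * (v - m₁) +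
        a * (v - m₁) ^ 2) / (2 * D)) * (-(d * (x - m₀) - b * (v - m₁)) / D)) x := by
  have hx := (hasDerivAt_id' x).sub_const m₀
  have h : HasDerivAt (fun x => -(d * (x - m₀) ^ 2 - 2 * b * (x - m₀) * (v - m₁) +
      a * (v - m₁) ^ 2) / (2 * D)) (-(d * (x - m₀) - b * (v - m₁)) / D) x := by
    refine ((((((hx.pow 2).const_mul d).sub ((hx.const_mul (2 * b)).mul_const (v - m₁))).add_const
      (a * (v - m₁) ^ 2)).neg.div_const (2 * D))).congr_deriv ?_
    simp only [Nat.cast_ofNat]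
    ring
  exact (h.exp.const_mul C).congr_deriv (mul_assoc _ _ _).symm

theorem hasDerivAt_bivariate_snd (m₀ m₁ a b d D C x v : ℝ) :
    HasDerivAt (fun v => C * Real.exp (-(d * (x - m₀) ^ 2 - 2 * b * (x - m₀) * (v - m₁) +
        a * (v - m₁) ^ 2) / (2 * D)))
      (C * Real.exp (-(d * (x - m₀) ^ 2 - 2 * b * (x - m₀) * (v - m₁) +
        a * (v - m₁) ^ 2) / (2 * D)) * (-(a * (v - m₁) - b * (x - m₀)) / D)) v := by
  have h := hasDerivAt_bivariate_fst m₁ m₀ d b a D C v x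
  have e : ∀ v, -(a * (v - m₁) ^ 2 - 2 * b * (v - m₁) * (x - m₀) + d * (x - m₀) ^ 2) / (2 * D) =
      -(d * (x - m₀) ^ 2 - 2 * b * (x - m₀) * (v - m₁) + a * (v - m₁) ^ 2) / (2 * D) := by
    intro v; ring
  simpa only [e] using h

/-- The time derivative of a bivariate Gaussian density whose mean and covariance satisfy the
moment equations of the oscillator equals the memFPK operator applied to it. -/
theorem hasDerivWithinAt_bivariate {m₀ m₁ a b d : ℝ → ℝ} {t : ℝ} {s : Set ℝ} {c k b₁ b₂ : ℝ}
    (hm₀ : HasDerivWithinAt m₀ (m₁ t) s t)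
    (hm₁ : HasDerivWithinAt m₁ (-k * m₀ t - c * m₁ t) s t)
    (ha : HasDerivWithinAt a (2 * b t) s t)
    (hb : HasDerivWithinAt b (d t - k * a t - c * b t + b₁) s t)
    (hd : HasDerivWithinAt d (2 * (-k * b t - c * d t + b₂)) s t)
    (hD : 0 < a t * d t - b t ^ 2) {q : ℝ → ℝ → ℝ → ℝ}
    (hq : ∀ x v t, q x v t = 1 / (2 * Real.pi * √(a t * d t - b t ^ 2)) *
      Real.exp (-(d t * (x - m₀ t) ^ 2 - 2 * b t * (x - m₀ t) * (v - m₁ t) +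
        a t * (v - m₁ t) ^ 2) / (2 * (a t * d t - b t ^ 2)))) (x v : ℝ) :
    HasDerivWithinAt (fun τ => q x v τ)
      (memFPKOperator c k b₁ b₂ (fun x' v' => q x' v' t) x v) s t := by
  set D := a t * d t - b t ^ 2 with hDdef
  have h1 : ∀ x v, HasDerivAt (fun x => q x v t)
      (q x v t * (-(d t * (x - m₀ t) - b t * (v - m₁ t)) / D)) x := by
    intro x v
    simp only [hq]
    exact hasDerivAt_bivariate_fst _ _ _ _ _ _ _ x v
  have h2 : ∀ x v, HasDerivAt (fun v => q x v t)
      (q x v t * (-(a t * (v - m₁ t) - b t * (x - m₀ t)) / D)) v := by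
    intro x v
    simp only [hq]
    exact hasDerivAt_bivariate_snd _ _ _ _ _ _ _ x v
  have hL : ∀ α β : ℝ, HasDerivAt (fun v' : ℝ => -(α * (v' - m₁ t) - β) / D) (-α / D) v := by
    intro α β
    have := (((((hasDerivAt_id' v).sub_const (m₁ t)).const_mul α).sub_const β).neg).div_const D
    simpa using this
  have h12 : HasDerivAt (fun v' => q x v' t * (-(d t * (x - m₀ t) - b t * (v' - m₁ t)) / D))
      (q x v t * (-(a t * (v - m₁ t) - b t * (x - m₀ t)) / D) *
        (-(d t * (x - m₀ t) - b t * (v - m₁ t)) / D) + q x v t * (b t / D)) v := by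
    refine (h2 x v).mul ((hL (-b t) (-(d t * (x - m₀ t)))).congr_deriv (by ring)
      |>.congr_of_eventuallyEq (Filter.Eventually.of_forall fun v' => ?_))
    ring
  have h22 : HasDerivAt (fun v' => q x v' t * (-(a t * (v' - m₁ t) - b t * (x - m₀ t)) / D))
      (q x v t * (-(a t * (v - m₁ t) - b t * (x - m₀ t)) / D) *
        (-(a t * (v - m₁ t) - b t * (x - m₀ t)) / D) + q x v t * (-a t / D)) v :=
    (h2 x v).mul (hL _ _)
  have hdrift : HasDerivAt (fun v' => (k * x + c * v') * q x v' t)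
      (c * q x v t + (k * x + c * v) *
        (q x v t * (-(a t * (v - m₁ t) - b t * (x - m₀ t)) / D))) v := by
    refine HasDerivAt.mul ?_ (h2 x v)
    simpa using ((hasDerivAt_id' v).const_mul c).const_add (k * x)
  have hop : memFPKOperator c k b₁ b₂ (fun x' v' => q x' v' t) x v =
      q x v t * (-v * (-(d t * (x - m₀ t) - b t * (v - m₁ t)) / D) + c +
        (k * x + c * v) * (-(a t * (v - m₁ t) - b t * (x - m₀ t)) / D) +
        b₁ * ((-(a t * (v - m₁ t) - b t * (x - m₀ t)) / D) *
          (-(d t * (x - m₀ t) - b t * (v - m₁ t)) / D) + b t / D) +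
        b₂ * ((-(a t * (v - m₁ t) - b t * (x - m₀ t)) / D) ^ 2 - a t / D)) := by
    unfold memFPKOperator
    simp only [(h1 _ _).deriv, (h2 _ _).deriv]
    rw [((h1 x v).const_mul v).deriv, hdrift.deriv, h12.deriv, h22.deriv]
    ring
  have hx := hm₀.const_sub x
  have hv := hm₁.const_sub v
  set D' := 2 * b t * d t + a t * (2 * (-k * b t - c * d t + b₂)) -
    2 * b t * (d t - k * a t - c * b t + b₁) with hD'
  have hDd : HasDerivWithinAt (fun τ => a τ * d τ - b τ ^ 2) D' s t := by
    refine ((ha.mul hd).sub (hb.pow 2)).congr_deriv ?_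
    simp only [hD', Nat.cast_ofNat]
    ring
  set N := d t * (x - m₀ t) ^ 2 - 2 * b t * (x - m₀ t) * (v - m₁ t) +
        a t * (v - m₁ t) ^ 2 with hN
  set N' := 2 * (-k * b t - c * d t + b₂) * (x - m₀ t) ^ 2 - 2 * d t * (x - m₀ t) * m₁ t -
    2 * (d t - k * a t - c * b t + b₁) * (x - m₀ t) * (v - m₁ t) +
    2 * b t * m₁ t * (v - m₁ t) + 2 * b t * (x - m₀ t) * (-k * m₀ t - c * m₁ t) +
    2 * b t * (v - m₁ t) ^ 2 - 2 * a t * (v - m₁ t) * (-k * m₀ t - c * m₁ t) with hN'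
  have hNd : HasDerivWithinAt (fun τ => d τ * (x - m₀ τ) ^ 2 -
      2 * b τ * (x - m₀ τ) * (v - m₁ τ) + a τ * (v - m₁ τ) ^ 2) N' s t := by
    refine (((hd.mul (hx.pow 2)).sub (((hb.const_mul 2).mul hx).mul hv)).add
      (ha.mul (hv.pow 2))).congr_deriv ?_
    simp only [hN', Nat.cast_ofNat]
    simp
    ring
  have hE : HasDerivWithinAt (fun τ => Real.exp (-(d τ * (x - m₀ τ) ^ 2 -
      2 * b τ * (x - m₀ τ) * (v - m₁ τ) + a τ * (v - m₁ τ) ^ 2) / (2 * (a τ * d τ - b τ ^ 2))))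
      (Real.exp (-N / (2 * D)) * ((-N' * (2 * D) - -N * (2 * D')) / (2 * D) ^ 2)) s t :=
    (hNd.neg.div (hDd.const_mul 2) (by positivity)).exp
  have hr := Real.sqrt_pos.2 hD
  have hr2 : √D ^ 2 = D := Real.sq_sqrt hD.le
  have hC : HasDerivWithinAt (fun τ => 1 / (2 * Real.pi * √(a τ * d τ - b τ ^ 2)))
      (1 / (2 * Real.pi * √D) * (-D' / (2 * D))) s t := by
    simp only [one_div]
    refine (((hDd.sqrt hD.ne').const_mul (2 * Real.pi)).inv (by positivity)).congr_deriv ?_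
    rw [← hDdef, ← hr2, Real.sqrt_sq hr.le]
    have := Real.pi_pos
    field_simp
  rw [hop]
  simp only [hq]
  refine (hC.mul hE).congr_deriv ?_
  -- With the density factored out, the left side is the time derivative of its logarithm, and the
  -- equation becomes a rational identity in the means, the covariances and the state.
  have key : -D' / (2 * D) + (-N' * (2 * D) - -N * (2 * D')) / (2 * D) ^ 2 =
      -v * (-(d t * (x - m₀ t) - b t * (v - m₁ t)) / D) + c +
        (k * x + c * v) * (-(a t * (v - m₁ t) - b t * (x - m₀ t)) / D) +
        b₁ * ((-(a t * (v - m₁ t) - b t * (x - m₀ t)) / D) *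
          (-(d t * (x - m₀ t) - b t * (v - m₁ t)) / D) + b t / D) +
        b₂ * ((-(a t * (v - m₁ t) - b t * (x - m₀ t)) / D) ^ 2 - a t / D) := by
    field_simp
    rw [hN', hD', hN, hDdef]
    ring
  rw [← hDdef, ← hN]
  linear_combination (1 / (2 * Real.pi * √D) * Real.exp (-N / (2 * D))) * key

end FokkerPlanck

/-! ### Pathwise solution. -/

section Path

/-- Variation of constants for the oscillator driven by a continuous path `b`. -/
theorem oscillator_variation_of_constants {c k σ x₀ v₀ : ℝ} {x v b : ℝ → ℝ} (hx : Continuous x)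
    (hv : Continuous v) (hb : Continuous b)
    (hX : ∀ t, 0 ≤ t → x t = x₀ + ∫ s in (0 : ℝ)..t, v s)
    (hV : ∀ t, 0 ≤ t → v t = v₀ - (∫ s in (0 : ℝ)..t, (k * x s + c * v s)) + σ * b t)
    {t : ℝ} (ht : 0 ≤ t) (i : Fin 2) :
    ![x t, v t] i = flow c k t i 0 * x₀ + flow c k t i 1 * v₀ +
      σ * ((1 : Matrix (Fin 2) (Fin 2) ℝ) i 1 * b t +
        ∫ s in (0 : ℝ)..t, flowDeriv c k i (t - s) * b s) := by
  -- For s ≥ 0, `y` is x and `w` is v - σb: removing the rough forcing leaves differentiable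
  -- functions. Being defined on all of ℝ, they have two-sided derivatives also at s = 0.
  set y : ℝ → ℝ := fun s => x₀ + ∫ r in (0 : ℝ)..s, v r with hy
  set w : ℝ → ℝ := fun s => v₀ - ∫ r in (0 : ℝ)..s, (k * x r + c * v r) with hw
  have hyd : ∀ s, HasDerivAt y (v s) s := fun s =>
    (hv.integral_hasStrictDerivAt 0 s).hasDerivAt.const_add x₀
  have hwd : ∀ s, HasDerivAt w (-(k * x s + c * v s)) s := fun s =>
    (((continuous_const.mul hx).add (continuous_const.mul hv)).integral_hasStrictDerivAt
      0 s).hasDerivAt.const_sub v₀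
  have hG : ∀ s, 0 ≤ s → HasDerivAt (fun s => flow c k (t - s) i 0 * y s + flow c k (t - s) i 1 * w s)
      (σ * (flowDeriv c k i (t - s) * b s)) s := by
    intro s hs
    have h0 := (hasDerivAt_flow_zero c k (t - s) i).comp_const_sub t s
    have h1 := (hasDerivAt_flow_one c k (t - s) i).comp_const_sub t s
    refine ((h0.mul (hyd s)).add (h1.mul (hwd s))).congr_deriv ?_
    have e1 : y s = x s := (hX s hs).symm
    have e2 : w s = v s - σ * b s := by rw [hV s hs]; ring
    rw [e1, e2, flowDeriv]
    ring
  have hcont : Continuous fun s => σ * (flowDeriv c k i (t - s) * b s) :=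
    continuous_const.mul (((continuous_flowDeriv c k i).comp (by fun_prop)).mul hb)
  have h := intervalIntegral.integral_eq_sub_of_hasDerivAt
    (fun s hs => hG s (by rw [uIcc_of_le ht] at hs; exact hs.1)) (hcont.intervalIntegrable 0 t)
  have hy0 : y 0 = x₀ := by simp [hy]
  have hw0 : w 0 = v₀ := by simp [hw]
  have hyt : x t = y t := hX t ht
  have hwt : v t = w t + σ * b t := hV t ht
  rw [intervalIntegral.integral_const_mul, sub_self, sub_zero, flow_zero, hy0, hw0] at h
  rw [mul_add, h, hyt, hwt]
  have hvec : ∀ (p r : ℝ) (i : Fin 2), ![p, r] i = (1 : Matrix (Fin 2) (Fin 2) ℝ) i 0 * p +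
      (1 : Matrix (Fin 2) (Fin 2) ℝ) i 1 * r := fun p r =>
    Fin.forall_fin_two.2 ⟨by simp, by simp⟩
  rw [hvec]
  ring

end Path

/-! ### The Gaussian family generated by the initial state and the noise. -/

section Family

variable {Ω : Type*} [MeasurableSpace Ω] {P : Measure Ω}

theorem hasGaussianLaw_add_const {Y : Ω → ℝ} (hY : HasGaussianLaw Y P) (r : ℝ) :
    HasGaussianLaw (fun ω => Y ω + r) P := by
  constructor
  have h : P.map (fun ω => Y ω + r) = (P.map Y).map (· + r) := by
    rw [AEMeasurable.map_map_of_aemeasurable (by fun_prop) hY.aemeasurable]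
    rfl
  rw [h, hY.map_eq_gaussianReal, gaussianReal_map_add_const]
  infer_instance

/-- The representation as a measurable functional of the path transfers independence from the whole
process to its linear combinations. -/
theorem mem_span_range_hasGaussianLaw {B : ℝ≥0 → Ω → ℝ} (hB : IsGaussianProcess B P)
    (h0 : ∀ t, ∫ ω, B t ω ∂P = 0) {Y : Ω → ℝ} (hY : Y ∈ Submodule.span ℝ (range B)) :
    HasGaussianLaw Y P ∧ ∫ ω, Y ω ∂P = 0 ∧
      ∃ φ : (ℝ≥0 → ℝ) → ℝ, Measurable φ ∧ Y = φ ∘ fun ω t => B t ω := by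
  obtain ⟨a, rfl⟩ := Finsupp.mem_span_range_iff_exists_finsupp.1 hY
  refine ⟨(hB.smul a).hasGaussianLaw_fun_sum (I := a.support) |>.congr
    (Filter.Eventually.of_forall fun ω => ?_), ?_, fun f => a.sum fun t r => r * f t, ?_, ?_⟩
  · simp [Finsupp.sum]
  · simp only [Finsupp.sum, Finset.sum_apply, Pi.smul_apply, smul_eq_mul]
    rw [integral_finsetSum _ fun t _ => ((hB.hasGaussianLaw_eval t).integrable.const_mul _)]
    simp [integral_const_mul, h0]
  · unfold Finsupp.sum
    fun_prop
  · ext ω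
    simp [Finsupp.sum]

/-- The initial state, centred, together with the driving process. -/
def noiseFamily (X₀ V₀ : Ω → ℝ) (m : Fin 2 → ℝ) (B : ℝ≥0 → Ω → ℝ) : Fin 2 ⊕ ℝ≥0 → Ω → ℝ :=
  Sum.elim ![fun ω => X₀ ω - m 0, fun ω => V₀ ω - m 1] B

/-- Each linear combination splits into an initial-state part and a noise part. Both are Gaussian
and they are independent, so their sum is Gaussian. -/
theorem isCentredGaussianFamily_noiseFamily [IsProbabilityMeasure P] {X₀ V₀ : Ω → ℝ}
    {m : Fin 2 → ℝ} {B : ℝ≥0 → Ω → ℝ} (hB : IsGaussianProcess B P)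
    (h0 : ∀ t, ∫ ω, B t ω ∂P = 0) (hXV : HasGaussianLaw (fun ω => (X₀ ω, V₀ ω)) P)
    (hX : ∫ ω, X₀ ω ∂P = m 0) (hV : ∫ ω, V₀ ω ∂P = m 1)
    (hind : IndepFun (fun ω => (X₀ ω, V₀ ω)) (fun ω t => B t ω) P) :
    IsCentredGaussianFamily (noiseFamily X₀ V₀ m B) P := by
  intro Y hY
  rw [noiseFamily, Sum.elim_range, Submodule.span_union, Submodule.mem_sup] at hY
  obtain ⟨y₁, hy₁, y₂, hy₂, rfl⟩ := hY
  obtain ⟨g2, m2, φ, hφ, rfl⟩ := mem_span_range_hasGaussianLaw hB h0 hy₂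
  obtain ⟨a, rfl⟩ := (Submodule.mem_span_range_iff_exists_fun ℝ).1 hy₁
  set y₁ : Ω → ℝ := ∑ i, a i • ![fun ω => X₀ ω - m 0, fun ω => V₀ ω - m 1] i with hy₁def
  have e1 : y₁ = (fun z : ℝ × ℝ => a 0 * (z.1 - m 0) + a 1 * (z.2 - m 1)) ∘
      fun ω => (X₀ ω, V₀ ω) := by
    ext ω
    simp [hy₁def, Fin.sum_univ_two]
  have g1 : HasGaussianLaw y₁ P := by
    have h := hasGaussianLaw_add_const (hXV.map (a 0 • ContinuousLinearMap.fst ℝ ℝ ℝ +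
      a 1 • ContinuousLinearMap.snd ℝ ℝ ℝ)) (-(a 0 * m 0 + a 1 * m 1))
    refine h.congr (Filter.Eventually.of_forall fun ω => ?_)
    simp [e1]
    ring
  have m1 : ∫ ω, y₁ ω ∂P = 0 := by
    have hiX := hXV.fst.integrable
    have hiV := hXV.snd.integrable
    simp only [e1, Function.comp_apply]
    have i1 : Integrable (fun ω => a 0 * (X₀ ω - m 0)) P :=
      (hiX.sub (integrable_const _)).const_mul _
    have i2 : Integrable (fun ω => a 1 * (V₀ ω - m 1)) P :=
      (hiV.sub (integrable_const _)).const_mul _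
    rw [integral_add i1 i2, integral_const_mul, integral_const_mul,
      integral_sub hiX (integrable_const _), integral_sub hiV (integrable_const _), hX, hV]
    simp
  have hind' : IndepFun y₁ (φ ∘ fun ω t => B t ω) P := by
    rw [e1]
    exact hind.comp (by fun_prop) hφ
  refine ⟨(hind'.hasGaussianLaw g1 g2).add, ?_⟩
  simp only [Pi.add_apply]
  rw [integral_add g1.integrable g2.integrable, m1, m2, add_zero]

theorem covariance_noiseFamily_inl_inr [IsProbabilityMeasure P] {X₀ V₀ : Ω → ℝ}
    {m : Fin 2 → ℝ} {B : ℝ≥0 → Ω → ℝ} (hB : IsGaussianProcess B P)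
    (hXV : HasGaussianLaw (fun ω => (X₀ ω, V₀ ω)) P)
    (hind : IndepFun (fun ω => (X₀ ω, V₀ ω)) (fun ω t => B t ω) P) (a : Fin 2) (t : ℝ≥0) :
    cov[noiseFamily X₀ V₀ m B (Sum.inl a), B t; P] = 0 := by
  have hX : IndepFun X₀ (B t) P := hind.comp measurable_fst (measurable_pi_apply t)
  have hV : IndepFun V₀ (B t) P := hind.comp measurable_snd (measurable_pi_apply t)
  have hBt := (hB.hasGaussianLaw_eval t).memLp_two
  fin_cases a
  · simp only [noiseFamily, Fin.zero_eta, Sum.elim_inl, cons_val_zero]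
    rw [covariance_sub_const_left hXV.fst.integrable]
    exact hX.covariance_eq_zero hXV.fst.memLp_two hBt
  · simp only [noiseFamily, Fin.mk_one, Sum.elim_inl, cons_val_one, cons_val_fin_one]
    rw [covariance_sub_const_left hXV.snd.integrable]
    exact hV.covariance_eq_zero hXV.snd.memLp_two hBt

theorem covariance_noiseFamily_inl_inl [IsProbabilityMeasure P] {X₀ V₀ : Ω → ℝ}
    {m : Fin 2 → ℝ} (B : ℝ≥0 → Ω → ℝ) {s : ℝ} (hX : HasGaussianLaw X₀ P)
    (hV : HasGaussianLaw V₀ P) (hXV : IndepFun X₀ V₀ P) (hvX : Var[X₀; P] = s ^ 2)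
    (hvV : Var[V₀; P] = s ^ 2) (a b : Fin 2) :
    cov[noiseFamily X₀ V₀ m B (Sum.inl a), noiseFamily X₀ V₀ m B (Sum.inl b); P] =
      (s ^ 2 • (1 : Matrix (Fin 2) (Fin 2) ℝ)) a b := by
  have h01 := hXV.covariance_eq_zero hX.memLp_two hV.memLp_two
  have h10 := hXV.symm.covariance_eq_zero hV.memLp_two hX.memLp_two
  rw [← covariance_self hX.aemeasurable] at hvX
  rw [← covariance_self hV.aemeasurable] at hvV
  fin_cases a <;> fin_cases b <;>
    simp [noiseFamily, covariance_sub_const_left, covariance_sub_const_right, hX.integrable,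
      hV.integrable, *]

end Family

/-! ### Covariance of the response to the noise. -/

section Noise

variable {Ω : Type*} [MeasurableSpace Ω] {P : Measure Ω}

/-- The response at time `t` of the oscillator at rest to the unit noise `dB`, with the stochastic
integral defined through integration by parts. -/
noncomputable def noiseResponse (c k : ℝ) (B : ℝ≥0 → Ω → ℝ) (i : Fin 2) (t : ℝ≥0) (ω : Ω) : ℝ :=
  (1 : Matrix (Fin 2) (Fin 2) ℝ) i 1 * B t ω +
    ∫ s in (0 : ℝ)..t, flowDeriv c k i (t - s) * B s.toNNReal ω

variable {T : Type*} {W : T → Ω → ℝ} {B : ℝ≥0 → Ω → ℝ}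

theorem noiseResponse_mem (hBW : ∀ t, B t ∈ Submodule.span ℝ (range W))
    (hcont : ∀ᵐ ω ∂P, Continuous fun t => B t ω) (c k : ℝ) (i : Fin 2) (t : ℝ≥0) :
    noiseResponse c k B i t ∈ gaussianClosure W P :=
  add_mem (Submodule.smul_mem _ ((1 : Matrix (Fin 2) (Fin 2) ℝ) i 1)
      (span_le_gaussianClosure (hBW t)))
    (integral_mem_gaussianClosure hBW hcont (f := fun s => flowDeriv c k i (t - s))
      ((continuous_flowDeriv c k i).comp (by fun_prop)) t.2)

theorem covariance_noiseResponse_left [IsProbabilityMeasure P] (hW : IsCentredGaussianFamily W P)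
    (hBW : ∀ t, B t ∈ Submodule.span ℝ (range W))
    (hcont : ∀ᵐ ω ∂P, Continuous fun t => B t ω) (c k : ℝ) (i : Fin 2) (t : ℝ≥0)
    {U : Ω → ℝ} (hU : U ∈ gaussianClosure W P) {K : ℝ → ℝ} (hK : Continuous K)
    (hKU : ∀ s : ℝ≥0, cov[B s, U; P] = K s) :
    cov[noiseResponse c k B i t, U; P] = (1 : Matrix (Fin 2) (Fin 2) ℝ) i 1 * K t +
      ∫ s in (0 : ℝ)..t, flowDeriv c k i (t - s) * K s := by
  have hf : Continuous fun s : ℝ => flowDeriv c k i (t - s) :=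
    (continuous_flowDeriv c k i).comp (by fun_prop)
  have h := covariance_integral_left hW hBW hcont hf t.2 hU hK
    (fun s hs => by rw [hKU, Real.coe_toNNReal _ hs])
  have hI := integral_mem_gaussianClosure hBW hcont hf t.2
  refine (covariance_add_left ((hW.memLp (span_le_gaussianClosure (hBW t))).const_smul
    ((1 : Matrix (Fin 2) (Fin 2) ℝ) i 1)) (hW.memLp hI) (hW.memLp hU)).trans ?_
  rw [covariance_smul_left, hKU, h]
  rfl

/-- The covariance passes through the integral in one argument and then in the other; the isometry
formula turns the result into the Riesz energy. -/
theorem covariance_noiseResponse [IsProbabilityMeasure P] {H : ℝ} (hH : 1 / 2 < H)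
    (hB : IsFractionalBrownianMotion H B P) (hW : IsCentredGaussianFamily W P)
    (hBW : ∀ t, B t ∈ Submodule.span ℝ (range W)) (c k : ℝ) (i j : Fin 2) (t : ℝ≥0) :
    cov[noiseResponse c k B i t, noiseResponse c k B j t; P] =
      H * (2 * H - 1) * rieszEnergy (2 * H - 2) c k i j t := by
  have hH0 : 0 < H := by linarith
  have hR := continuous_fbmCov hH0
  have hφ0 : ∀ i : Fin 2, (1 : Matrix (Fin 2) (Fin 2) ℝ) i 1 = flow c k 0 i 1 := by
    simp [flow_zero]
  have hcont := hB.continuous_paths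
  have h1 : ∀ (j : Fin 2) (u : ℝ≥0), cov[B u, noiseResponse c k B j t; P] =
      noiseCovFbm H (fun r => flow c k r j 1) (flowDeriv c k j) t u := by
    intro j u
    rw [covariance_comm, covariance_noiseResponse_left hW hBW hcont c k j t
      (span_le_gaussianClosure (hBW u)) (K := fun s => fbmCov H s u)
      (hR.comp (by fun_prop : Continuous fun s : ℝ => (s, (u : ℝ)))) (fun s => ?_), hφ0]
    · rfl
    · rw [hB.covariance, fbmCov, abs_sub_comm]
  rw [covariance_noiseResponse_left hW hBW hcont c k i t (noiseResponse_mem hBW hcont c k j t)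
    (continuous_noiseCovFbm hH0 _ (continuous_flowDeriv c k j) t) (h1 j), hφ0]
  exact (integral_integral_riesz_eq_noiseCov hH (fun x => hasDerivAt_flow_one c k x i)
    (continuous_flowDeriv c k i) (fun x => hasDerivAt_flow_one c k x j)
    (continuous_flowDeriv c k j) t.2).symm

theorem posSemidef_covariance [IsProbabilityMeasure P] {Y : Fin 2 → Ω → ℝ}
    (hY : ∀ i, MemLp (Y i) 2 P) : (Matrix.of fun i j => cov[Y i, Y j; P]).PosSemidef := by
  refine .of_dotProduct_mulVec_nonneg ?_ fun x => ?_
  · ext i j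
    simp [covariance_comm]
  · have h := variance_nonneg (∑ i, x i • Y i) P
    rw [variance_sum fun i => (hY i).const_smul (x i)] at h
    simp only [covariance_smul_left, covariance_smul_right] at h
    convert! h using 1
    simp only [dotProduct, mulVec, Fin.sum_univ_two, Matrix.of_apply, Pi.star_apply, star_trivial]
    ring

end Noise

/-! ### The response as a Gaussian process. -/

section Response

variable {Ω : Type*} [MeasurableSpace Ω] {P : Measure Ω}

theorem covariance_congr_ae {X X' Y Y' : Ω → ℝ} (hX : X =ᵐ[P] X') (hY : Y =ᵐ[P] Y') :
    cov[X, Y; P] = cov[X', Y'; P] := by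
  rw [covariance, covariance, integral_congr_ae hX, integral_congr_ae hY]
  refine integral_congr_ae ?_
  filter_upwards [hX, hY] with ω h h'
  rw [h, h']

/-- Starting at 0 is not part of the definition; it follows from zero mean and zero variance at time
0. -/
theorem IsFractionalBrownianMotion.ae_zero [IsProbabilityMeasure P] {H : ℝ} (hH : 0 < H)
    {B : ℝ≥0 → Ω → ℝ} (hB : IsFractionalBrownianMotion H B P) : ∀ᵐ ω ∂P, B 0 ω = 0 := by
  have hL := (hB.gaussian.hasGaussianLaw_eval 0)
  have hv : Var[B 0; P] = 0 := by
    rw [← covariance_self hL.aemeasurable, hB.covariance]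
    simp [Real.zero_rpow (show 2 * H ≠ 0 by linarith)]
  have h := ae_eq_integral_of_variance_eq_zero hL.memLp_two hv
  rwa [hB.mean_zero] at h

/-- The centred response of the oscillator, in terms of the centred initial state and the noise. -/
noncomputable def centredResponse (c k σ : ℝ) (X₀ V₀ : Ω → ℝ) (m : Fin 2 → ℝ) (B : ℝ≥0 → Ω → ℝ)
    (i : Fin 2) (t : ℝ≥0) : Ω → ℝ :=
  (∑ a, flow c k t i a • noiseFamily X₀ V₀ m B (Sum.inl a)) + σ • noiseResponse c k B i t

theorem oscillator_eq_centredResponse [IsProbabilityMeasure P] {H c k σ : ℝ} (hH : 0 < H)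
    {B X V : ℝ≥0 → Ω → ℝ} (hB : IsFractionalBrownianMotion H B P)
    (hXV : IsOscillatorSolution c k σ B X V P) (m : Fin 2 → ℝ) :
    ∀ᵐ ω ∂P, ∀ (t : ℝ≥0) (i : Fin 2), ![X t ω, V t ω] i =
      centredResponse c k σ (X 0) (V 0) m B i t ω + responseMean c k m t i := by
  filter_upwards [hXV, hB.continuous_paths, hB.ae_zero hH] with ω hω hBc hB0 t i
  obtain ⟨hX, hV, heq⟩ := hω
  have h := oscillator_variation_of_constants (c := c) (k := k) (σ := σ) (x₀ := X 0 ω)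
    (v₀ := V 0 ω) (hX.comp continuous_real_toNNReal) (hV.comp continuous_real_toNNReal)
    (hBc.comp continuous_real_toNNReal)
    (fun s hs => by simpa [Real.coe_toNNReal _ hs] using (heq s.toNNReal).1)
    (fun s hs => by simpa [Real.coe_toNNReal _ hs, hB0] using (heq s.toNNReal).2) t.2 i
  simp only [Function.comp_apply, NNReal.val_eq_coe, Real.toNNReal_coe] at h
  rw [h]
  simp only [centredResponse, responseMean, noiseResponse, noiseFamily, Pi.add_apply,
    Pi.smul_apply, smul_eq_mul, Fin.sum_univ_two, mulVec, dotProduct,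
    Sum.elim_inl, cons_val_zero, cons_val_one, cons_val_fin_one]
  ring

theorem centredResponse_mem {c k σ : ℝ} {X₀ V₀ : Ω → ℝ} {m : Fin 2 → ℝ} {B : ℝ≥0 → Ω → ℝ}
    (hcont : ∀ᵐ ω ∂P, Continuous fun t => B t ω) (i : Fin 2) (t : ℝ≥0) :
    centredResponse c k σ X₀ V₀ m B i t ∈ gaussianClosure (noiseFamily X₀ V₀ m B) P :=
  add_mem (sum_mem fun a _ => Submodule.smul_mem _ _ (apply_mem_gaussianClosure (Sum.inl a)))
    (Submodule.smul_mem _ _ (noiseResponse_mem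
      (fun t => Submodule.subset_span ⟨Sum.inr t, rfl⟩) hcont c k i t))

theorem covariance_centredResponse [IsProbabilityMeasure P] {H c k σ : ℝ} (hH : 1 / 2 < H)
    {X₀ V₀ : Ω → ℝ} {m : Fin 2 → ℝ} {B : ℝ≥0 → Ω → ℝ} (hB : IsFractionalBrownianMotion H B P)
    (hW : IsCentredGaussianFamily (noiseFamily X₀ V₀ m B) P) {S₀ : Matrix (Fin 2) (Fin 2) ℝ}
    (hS₀ : ∀ a b, cov[noiseFamily X₀ V₀ m B (Sum.inl a), noiseFamily X₀ V₀ m B (Sum.inl b); P] =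
      S₀ a b)
    (h0 : ∀ (a : Fin 2) (s : ℝ≥0), cov[noiseFamily X₀ V₀ m B (Sum.inl a), B s; P] = 0)
    (i j : Fin 2) (t : ℝ≥0) :
    cov[centredResponse c k σ X₀ V₀ m B i t, centredResponse c k σ X₀ V₀ m B j t; P] =
      responseCov H c k σ S₀ t i j := by
  have hBW : ∀ t, B t ∈ Submodule.span ℝ (range (noiseFamily X₀ V₀ m B)) :=
    fun t => Submodule.subset_span ⟨Sum.inr t, rfl⟩
  have hcont := hB.continuous_paths
  have hN : ∀ i, noiseResponse c k B i t ∈ gaussianClosure (noiseFamily X₀ V₀ m B) P := fun i =>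
    noiseResponse_mem hBW hcont c k i t
  have hinit : ∀ a : Fin 2, noiseFamily X₀ V₀ m B (Sum.inl a) ∈
      gaussianClosure (noiseFamily X₀ V₀ m B) P := fun a => apply_mem_gaussianClosure (Sum.inl a)
  have hcross : ∀ (i a : Fin 2),
      cov[noiseResponse c k B i t, noiseFamily X₀ V₀ m B (Sum.inl a); P] = 0 := by
    intro i a
    rw [covariance_noiseResponse_left hW hBW hcont c k i t (hinit a) (K := fun _ => 0)
      continuous_const (fun s => by rw [covariance_comm, h0])]
    simp
  have hcross' : ∀ (i a : Fin 2),
      cov[noiseFamily X₀ V₀ m B (Sum.inl a), noiseResponse c k B i t; P] = 0 := fun i a => by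
    rw [covariance_comm, hcross]
  have hA : ∀ i, MemLp (∑ a, flow c k t i a • noiseFamily X₀ V₀ m B (Sum.inl a)) 2 P := fun i =>
    hW.memLp (sum_mem fun a _ => Submodule.smul_mem _ _ (hinit a))
  have hAa : ∀ i a, MemLp (flow c k t i a • noiseFamily X₀ V₀ m B (Sum.inl a)) 2 P := fun i a =>
    hW.memLp (Submodule.smul_mem _ _ (hinit a))
  have hσN : ∀ i, MemLp (σ • noiseResponse c k B i t) 2 P := fun i =>
    hW.memLp (Submodule.smul_mem _ _ (hN i))
  rw [centredResponse, centredResponse, covariance_add_left (hA i) (hσN i) ((hA j).add (hσN j)),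
    covariance_add_right (hA i) (hA j) (hσN j), covariance_add_right (hσN i) (hA j) (hσN j),
    covariance_sum_sum (hAa i) (hAa j), covariance_sum_left (hAa i) (hσN j),
    covariance_sum_right (hAa j) (hσN i)]
  simp only [covariance_smul_left, covariance_smul_right, hS₀, hcross, hcross',
    covariance_noiseResponse hH hB hW hBW, mul_zero, Finset.sum_const_zero, add_zero, zero_add]
  rw [responseCov_apply]
  simp only [Matrix.mul_apply, Fin.sum_univ_two, transpose_apply]
  ring

/-- The Riesz part is positive semidefinite because it is the covariance of the noise response, so
no positivity of the kernel has to be shown analytically. The invertible flow keeps the initial part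
positive definite. -/
theorem posDef_responseCov [IsProbabilityMeasure P] {H : ℝ} (c k σ : ℝ) (hH : 1 / 2 < H)
    {T : Type*} {W : T → Ω → ℝ} {B : ℝ≥0 → Ω → ℝ} (hB : IsFractionalBrownianMotion H B P)
    (hW : IsCentredGaussianFamily W P) (hBW : ∀ t, B t ∈ Submodule.span ℝ (range W))
    {S₀ : Matrix (Fin 2) (Fin 2) ℝ} (hS₀ : S₀.PosDef) (t : ℝ≥0) :
    (responseCov H c k σ S₀ t).PosDef := by
  have h1 : (flow c k t * S₀ * (flow c k t)ᵀ).PosDef := by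
    rw [← conjTranspose_eq_transpose_of_trivial]
    refine hS₀.mul_mul_conjTranspose_same (vecMul_injective_of_isUnit ?_)
    exact Matrix.isUnit_exp _
  have h2 := posSemidef_covariance (P := P) (Y := fun i => σ • noiseResponse c k B i t) fun i =>
    hW.memLp (Submodule.smul_mem _ _ (noiseResponse_mem hBW hB.continuous_paths c k i t))
  convert! h1.add_posSemidef h2 using 1
  ext i j
  rw [responseCov_apply, Matrix.add_apply, Matrix.of_apply, covariance_smul_left,
    covariance_smul_right, covariance_noiseResponse hH hB hW hBW]
  ring

/-- A finite-dimensional vector is Gaussian once all its linear functionals are. A functional of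
finitely many states is, up to a constant, a linear combination of members of the closure, which is
a linear space of Gaussian variables. -/
theorem isGaussianProcess_of_mem_gaussianClosure [IsProbabilityMeasure P] {T : Type*}
    {W : T → Ω → ℝ} (hW : IsCentredGaussianFamily W P) {X V : ℝ≥0 → Ω → ℝ} {Z : Fin 2 → ℝ≥0 → Ω → ℝ}
    {μ : ℝ → Fin 2 → ℝ} (hZ : ∀ i t, Z i t ∈ gaussianClosure W P)
    (hXV : ∀ᵐ ω ∂P, ∀ (t : ℝ≥0) (i : Fin 2), ![X t ω, V t ω] i = Z i t ω + μ t i) :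
    IsGaussianProcess (fun (t : ℝ≥0) ω => (X t ω, V t ω)) P := by
  have hXV' : ∀ᵐ ω ∂P, ∀ t : ℝ≥0, X t ω = Z 0 t ω + μ t 0 ∧ V t ω = Z 1 t ω + μ t 1 := by
    filter_upwards [hXV] with ω h t
    exact ⟨by simpa using h t 0, by simpa using h t 1⟩
  have hXm : ∀ t, AEMeasurable (X t) P := fun t =>
    ((hW.closure (hZ 0 t)).1.aemeasurable.add_const (μ t 0)).congr
      (by filter_upwards [hXV'] with ω h using (h t).1.symm)
  have hVm : ∀ t, AEMeasurable (V t) P := fun t =>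
    ((hW.closure (hZ 1 t)).1.aemeasurable.add_const (μ t 1)).congr
      (by filter_upwards [hXV'] with ω h using (h t).2.symm)
  refine ⟨fun I => ⟨isGaussian_of_isGaussian_map fun L => ?_⟩⟩
  have hvec : AEMeasurable (fun ω => I.restrict fun t => (X t ω, V t ω)) P :=
    aemeasurable_pi_lambda _ fun t => (hXm t).prodMk (hVm t)
  rw [AEMeasurable.map_map_of_aemeasurable L.continuous.measurable.aemeasurable hvec]
  have hL : ∀ f : I → ℝ × ℝ, L f = ∑ t, ((f t).1 * L (Pi.single t (1, 0)) +
      (f t).2 * L (Pi.single t (0, 1))) := by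
    intro f
    have hf : f = ∑ t, ((f t).1 • (Pi.single t (1, 0) : I → ℝ × ℝ) +
        (f t).2 • (Pi.single t (0, 1) : I → ℝ × ℝ)) := by
      conv_lhs => rw [← Finset.univ_sum_single f]
      refine Finset.sum_congr rfl fun t _ => ?_
      rw [← Pi.single_smul, ← Pi.single_smul, ← Pi.single_add]
      congr 1
      ext <;> simp
    conv_lhs => rw [hf]
    simp
  set G : Ω → ℝ := ∑ t : I, (L (Pi.single t (1, 0)) • Z 0 t + L (Pi.single t (0, 1)) • Z 1 t)
    with hGdef
  have hG : G ∈ gaussianClosure W P := sum_mem fun t _ => add_mem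
    (Submodule.smul_mem _ _ (hZ 0 t)) (Submodule.smul_mem _ _ (hZ 1 t))
  refine ((hasGaussianLaw_add_const (hW.closure hG).1
    (∑ t : I, (L (Pi.single t (1, 0)) * μ t 0 + L (Pi.single t (0, 1)) * μ t 1))).congr
    ?_).isGaussian_map
  filter_upwards [hXV'] with ω h
  rw [Function.comp_apply, hL, hGdef, Finset.sum_apply, ← Finset.sum_add_distrib]
  refine Finset.sum_congr rfl fun t _ => ?_
  simp only [Finset.restrict, (h t).1, (h t).2, Pi.add_apply, Pi.smul_apply, smul_eq_mul]
  ring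

theorem hasDerivAt_responseMean (c k : ℝ) (m : Fin 2 → ℝ) (t : ℝ) (i : Fin 2) :
    HasDerivAt (fun t => responseMean c k m t i)
      (∑ a, driftMatrix c k i a * responseMean c k m t a) t := by
  simp only [responseMean, mulVec, dotProduct]
  refine (HasDerivAt.fun_sum fun b _ => (hasDerivAt_flow' c k t i b).mul_const (m b)).congr_deriv ?_
  simp only [Matrix.mul_apply, Fin.sum_univ_two]
  ring

end Response

end FGNOscillator

theorem mainTheorem2 {Ω : Type*} [MeasurableSpace Ω] (P : Measure Ω) [IsProbabilityMeasure P]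
    (H c k σ σ₀ : ℝ) (μ₀ : Fin 2 → ℝ)
    (hH : 1 / 2 < H) (hH' : H < 1) (hσ₀ : 0 < σ₀)
    (B X V : ℝ≥0 → Ω → ℝ)
    (hB : FGNOscillator.IsFractionalBrownianMotion H B P)
    (hXV : FGNOscillator.IsOscillatorSolution c k σ B X V P)
    (hinit : FGNOscillator.IsJointPDF (X 0) (V 0) P
      fun x v => FGNOscillator.gaussianDensity μ₀ (σ₀ ^ 2 • (1 : Matrix (Fin 2) (Fin 2) ℝ)) ![x, v])
    (hindep : IndepFun (fun ω => (X 0 ω, V 0 ω)) (fun ω t => B t ω) P) :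
    -- the response is a Gaussian process
    IsGaussianProcess (fun (t : ℝ≥0) ω => (X t ω, V t ω)) P ∧
    -- mean vector and covariance matrix of the response
    (∀ t : ℝ≥0,
      (∀ i, ∫ ω, ![X t ω, V t ω] i ∂P = FGNOscillator.responseMean c k μ₀ t i) ∧
      (∀ i j, cov[fun ω => ![X t ω, V t ω] i, fun ω => ![X t ω, V t ω] j; P] =
        FGNOscillator.responseCov H c k σ (σ₀ ^ 2 • (1 : Matrix (Fin 2) (Fin 2) ℝ)) t i j) ∧
      (FGNOscillator.responseCov H c k σ (σ₀ ^ 2 • (1 : Matrix (Fin 2) (Fin 2) ℝ)) t).PosDef) ∧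
    ∃ p : ℝ → ℝ → ℝ → ℝ,
      -- `p(·, ·, t)` is the (smooth version of the) joint density of `(X(t), V(t))`
      (∀ t : ℝ≥0, FGNOscillator.IsJointPDF (X t) (V t) P (fun x v => p x v t) ∧
        ContDiff ℝ (⊤ : ℕ∞) fun z : ℝ × ℝ => p z.1 z.2 t) ∧
      -- it is the explicit Gaussian density
      (∀ x v t : ℝ, 0 ≤ t →
        p x v t = FGNOscillator.gaussianDensity (FGNOscillator.responseMean c k μ₀ t)
          (FGNOscillator.responseCov H c k σ (σ₀ ^ 2 • (1 : Matrix (Fin 2) (Fin 2) ℝ)) t)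
          ![x, v]) ∧
      -- it satisfies the memFPK equation (with the right derivative at `t = 0`)
      (∀ x v t : ℝ, 0 ≤ t →
        HasDerivWithinAt (fun τ => p x v τ)
          (FGNOscillator.memFPKOperator c k
            (FGNOscillator.memDiffusion H c k σ 0 1 t)
            (FGNOscillator.memDiffusion H c k σ 1 1 t)
            (fun x' v' => p x' v' t) x v)
          (Set.Ici 0) t) := by
  obtain ⟨hind0, hlX, hlV⟩ := FGNOscillator.IsJointPDF.of_isotropic hσ₀ hinit
  set S₀ : Matrix (Fin 2) (Fin 2) ℝ := σ₀ ^ 2 • 1 with hS₀def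
  have hS₀ : S₀.PosDef := PosDef.one.smul (by positivity)
  have hlawX : HasLaw (X 0) (gaussianReal (μ₀ 0) (σ₀ ^ 2).toNNReal) P := ⟨hinit.1, hlX⟩
  have hlawV : HasLaw (V 0) (gaussianReal (μ₀ 1) (σ₀ ^ 2).toNNReal) P := ⟨hinit.2.1, hlV⟩
  have hgXV := hind0.hasGaussianLaw hlawX.hasGaussianLaw hlawV.hasGaussianLaw
  have hW := FGNOscillator.isCentredGaussianFamily_noiseFamily (m := μ₀) hB.gaussian hB.mean_zero
    hgXV (by rw [hlawX.integral_eq]; simp) (by rw [hlawV.integral_eq]; simp) hindep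
  have hBW : ∀ t, B t ∈ Submodule.span ℝ (range (FGNOscillator.noiseFamily (X 0) (V 0) μ₀ B)) :=
    fun t => Submodule.subset_span ⟨Sum.inr t, rfl⟩
  have hZ : ∀ i t, FGNOscillator.centredResponse c k σ (X 0) (V 0) μ₀ B i t ∈
      FGNOscillator.gaussianClosure (FGNOscillator.noiseFamily (X 0) (V 0) μ₀ B) P :=
    FGNOscillator.centredResponse_mem hB.continuous_paths
  have hae := FGNOscillator.oscillator_eq_centredResponse (by linarith) hB hXV μ₀
  have haei : ∀ (t : ℝ≥0) (i : Fin 2), (fun ω => ![X t ω, V t ω] i) =ᵐ[P] fun ω =>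
      FGNOscillator.centredResponse c k σ (X 0) (V 0) μ₀ B i t ω +
        FGNOscillator.responseMean c k μ₀ t i := fun t i => by
    filter_upwards [hae] with ω h using h t i
  have hGP := FGNOscillator.isGaussianProcess_of_mem_gaussianClosure hW hZ hae
  have hint : ∀ i t, Integrable (FGNOscillator.centredResponse c k σ (X 0) (V 0) μ₀ B i t) P :=
    fun i t => (hW.closure (hZ i t)).1.integrable
  have hmean : ∀ (t : ℝ≥0) i, ∫ ω, ![X t ω, V t ω] i ∂P =
      FGNOscillator.responseMean c k μ₀ t i := by
    intro t i
    rw [integral_congr_ae (haei t i), integral_add (hint i t) (integrable_const _),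
      (hW.closure (hZ i t)).2]
    simp
  have hcov : ∀ (t : ℝ≥0) i j, cov[fun ω => ![X t ω, V t ω] i, fun ω => ![X t ω, V t ω] j; P] =
      FGNOscillator.responseCov H c k σ S₀ t i j := by
    intro t i j
    rw [FGNOscillator.covariance_congr_ae (haei t i) (haei t j), covariance_add_const_left (hint i t),
      covariance_add_const_right (hint j t)]
    exact FGNOscillator.covariance_centredResponse hH hB hW
      (FGNOscillator.covariance_noiseFamily_inl_inl B hlawX.hasGaussianLaw hlawV.hasGaussianLaw
        hind0 (by rw [hlawX.variance_eq]; simp [sq_nonneg])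
        (by rw [hlawV.variance_eq]; simp [sq_nonneg]))
      (FGNOscillator.covariance_noiseFamily_inl_inr hB.gaussian hgXV hindep) i j t
  have hpos : ∀ t : ℝ, 0 ≤ t → (FGNOscillator.responseCov H c k σ S₀ t).PosDef := fun t ht =>
    FGNOscillator.posDef_responseCov c k σ hH hB hW hBW hS₀ ⟨t, ht⟩
  have hsymm : ∀ t : ℝ, 0 ≤ t → FGNOscillator.responseCov H c k σ S₀ t 1 0 =
      FGNOscillator.responseCov H c k σ S₀ t 0 1 := fun t ht => by
    simpa using (hpos t ht).isHermitian.apply 0 1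
  -- The explicit formula serves as `p` for every real time; its values at negative times play no
  -- role.
  refine ⟨hGP, fun t => ⟨hmean t, hcov t, hpos t t.2⟩,
    fun x v t => FGNOscillator.gaussianDensity (FGNOscillator.responseMean c k μ₀ t)
      (FGNOscillator.responseCov H c k σ S₀ t) ![x, v], fun t => ⟨?_, ?_⟩, fun _ _ _ _ => rfl, ?_⟩
  · exact FGNOscillator.isJointPDF_of_hasGaussianLaw (hGP.hasGaussianLaw_eval t) (hpos t t.2)
      (hmean t) (hcov t)
  · exact FGNOscillator.contDiff_gaussianDensity _ (hsymm t t.2)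
  · intro x v t ht
    have hmd := FGNOscillator.hasDerivAt_responseMean c k μ₀ t
    have hSd := FGNOscillator.hasDerivWithinAt_responseCov hH c k σ S₀ ht
    have hdet : 0 < FGNOscillator.responseCov H c k σ S₀ t 0 0 *
        FGNOscillator.responseCov H c k σ S₀ t 1 1 -
        FGNOscillator.responseCov H c k σ S₀ t 0 1 ^ 2 := by
      have := (hpos t ht).det_pos
      rw [det_fin_two, hsymm t ht] at this
      linarith [sq (FGNOscillator.responseCov H c k σ S₀ t 0 1)]
    have h := FGNOscillator.hasDerivWithinAt_bivariate (s := Ici 0) (c := c) (k := k)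
      (b₁ := FGNOscillator.memDiffusion H c k σ 0 1 t)
      (b₂ := FGNOscillator.memDiffusion H c k σ 1 1 t)
      ((hmd 0).hasDerivWithinAt.congr_deriv
        (by simp [FGNOscillator.driftMatrix, Fin.sum_univ_two]))
      ((hmd 1).hasDerivWithinAt.congr_deriv
        (by simp [FGNOscillator.driftMatrix, Fin.sum_univ_two]; ring))
      ((hSd 0 0).congr_deriv
        (by simp [FGNOscillator.driftMatrix, Fin.sum_univ_two, hsymm t ht]; ring))
      ((hSd 0 1).congr_deriv
        (by simp [FGNOscillator.driftMatrix, Fin.sum_univ_two]; ring))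
      ((hSd 1 1).congr_deriv
        (by simp [FGNOscillator.driftMatrix, Fin.sum_univ_two, hsymm t ht]; ring))
      hdet (fun _ _ _ => rfl) x v
    -- The scalar form of the density needs a symmetric covariance, known here only for τ ≥ 0; this
    -- suffices for a derivative within [0, ∞).
    have hq : ∀ x v τ, 0 ≤ τ → FGNOscillator.gaussianDensity (FGNOscillator.responseMean c k μ₀ τ)
        (FGNOscillator.responseCov H c k σ S₀ τ) ![x, v] = _ := fun x v τ hτ =>
      FGNOscillator.gaussianDensity_fin_two (FGNOscillator.responseMean c k μ₀ τ) (hsymm τ hτ) x v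
    simp only [hq _ _ t ht]
    exact h.congr_of_mem (fun τ hτ => hq x v τ hτ) ht
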